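/- **Conventions.** Let $A$ be a C*-algebra of the form $B(\mathbb{C}^m)$ or a (possibly infinite) direct sum $\bigoplus_{j\in\Lambda} B(\mathbb{C}^{m_j})=\{(x_j)_{j\in\Lambda} : \sup_j\|x_j\|<\infty\}$ with pointwise operations and the supremum norm. $P(A)$ denotes its lattice of projections, and $\mathcal{E}(A)=\{x\in A : x\ge 0,\ \|x\|\le 1\}$ its set of effects. The spectral family of a self-adjoint $x\in A$ is the family $(E^x_\lambda)_{\lambda\in\mathbb{R}}$ in $P(A)$ that is increasing, satisfies $E^x_\lambda=\bigwedge_{\mu>\lambda}E^x_\mu$ for all $\lambda$, is $0$ for $\lambda<-\alpha$ and $1$ for $\lambda>\alpha$ for some real $\alpha>0$, and satisfies $xE^x_\lambda\le\lambda E^x_\lambda$ and $\lambda(1-E^x_\lambda)\le x(1-E^x_\lambda)$ for all $\lambda$. The spectral order on self-adjoint elements is defined by $x\preceq y$ if and only if $E^y_\lambda\le E^x_\lambda$ for all $\lambda\in\mathbb{R}$. A spectral order isomorphism $\Phi:\mathcal{E}(A)\to\mathcal{E}(B)$ is a bijection such that $x\preceq y\iff\Phi(x)\preceq\Phi(y)$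 for all $x,y\in\mathcal{E}(A)$. A projection automorphism of $P(A)$ is a bijection $\tau:P(A)\to P(A)$ with $p\le q\iff\tau(p)\le\tau(q)$ for all $p,q$. For such $\tau$ and self-adjoint $x$, $\Theta_\tau(x)$ is the self-adjoint element with $E^{\Theta_\tau(x)}_\lambda=\tau(E^x_\lambda)$ for all $\lambda\in\mathbb{R}$. **Corollary 3.3.** Let $\mathcal{M}=\bigoplus_{j\in\Lambda}B(\mathbb{C}^{m_j})$ and $\mathcal{N}=\bigoplus_{k\in\Gamma}B(\mathbb{C}^{n_k})$, where $\Lambda,\Gamma$ are arbitrary index sets and all $m_j,n_k$ are positive integers. If $\Phi:\mathcal{E}(\mathcal{M})\to\mathcal{E}(\mathcal{N})$ is a spectral order isomorphism, then there are a bijection $\pi:\Gamma\to\Lambda$ with $m_{\pi(k)}=n_k$ for all $k\in\Gamma$, a family $(f_j)_{j\in\Lambda}$ of strictly increasing bijections $f_j:[0,1]\to[0,1]$, and a family $(\tau_j)_{j\in\Lambda}$ of projection automorphisms $\tau_j:P(B(\mathbb{C}^{m_j}))\to P(B(\mathbb{C}^{m_j}))$ such that $$\Phi\big((x_j)_{j\in\Lambda}\big)=\big(\Theta_{\tau_{\pi(k)}}(f_{\pi(k)}(x_{\pi(k)}))\big)_{k\in\Gamma}\qquad\text{for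 all }(x_j)_{j\in\Lambda}\in\mathcal{E}(\mathcal{M}),$$ where $f_j(x_j)$ is given by continuous functional calculus. -/

import Mathlib

open scoped ENNReal

noncomputable section

/-- The algebra `B(ℂᵐ)` of all bounded operators on the Hilbert space `ℂᵐ`, with the operator norm,
the adjoint as involution and the usual (Loewner) order of operators. -/
abbrev MatAlg (m : ℕ) : Type :=
  EuclideanSpace ℂ (Fin m) →L[ℂ] EuclideanSpace ℂ (Fin m)

section DirectSum

variable {J : Type*} (A : J → Type*) [∀ j, CStarAlgebra (A j)] [∀ j, Nontrivial (A j)]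

/-- The direct sum of a family of C⋆-algebras is the algebra of its bounded families with pointwise
operations and the supremum norm. -/
abbrev DirectSumAlg : Type _ := lp A ∞

instance DirectSumAlg.instCStarAlgebra : CStarAlgebra (DirectSumAlg A) where
  star_smul := star_smul

variable [∀ j, PartialOrder (A j)]

/-- The order of a direct sum is the pointwise one. It is the C⋆-algebra order, see
`DirectSumAlg.instStarOrderedRing`. -/
instance DirectSumAlg.instPartialOrder : PartialOrder (DirectSumAlg A) :=
  PartialOrder.lift (fun x : DirectSumAlg A => (x : ∀ j, A j)) (fun _ _ h => lp.ext h)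

variable [∀ j, StarOrderedRing (A j)]

/-- `x ≤ y` holds in a direct sum if and only if `y - x` has the form `star s * s`. -/
instance DirectSumAlg.instStarOrderedRing : StarOrderedRing (DirectSumAlg A) := by
  refine StarOrderedRing.of_le_iff (fun x y => ⟨fun h => ?_, ?_⟩)
  · have hj : ∀ j, 0 ≤ y j - x j := fun j => sub_nonneg.mpr (h j)
    have hsa : ∀ j, star (CFC.sqrt (y j - x j)) = CFC.sqrt (y j - x j) := fun j =>
      (CFC.sqrt_nonneg (y j - x j)).isSelfAdjoint
    have hmul : ∀ j, star (CFC.sqrt (y j - x j)) * CFC.sqrt (y j - x j) = y j - x j := fun j => by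
      rw [hsa j, CFC.sqrt_mul_sqrt_self _ (hj j)]
    have hs : Memℓp (fun j => CFC.sqrt (y j - x j)) ∞ := by
      refine memℓp_infty ⟨‖y - x‖ + 1, ?_⟩
      rintro _ ⟨j, rfl⟩
      have h1 : ‖y j - x j‖ ≤ ‖y - x‖ := lp.norm_apply_le_norm ENNReal.top_ne_zero (y - x) j
      have h2 : ‖CFC.sqrt (y j - x j)‖ * ‖CFC.sqrt (y j - x j)‖ = ‖y j - x j‖ := by
        rw [← CStarRing.norm_star_mul_self, hmul j]
      nlinarith [norm_nonneg (CFC.sqrt (y j - x j))]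
    refine ⟨⟨_, hs⟩, ?_⟩
    ext j
    change y j = x j + star (CFC.sqrt (y j - x j)) * CFC.sqrt (y j - x j)
    rw [hmul j, add_sub_cancel]
  · rintro ⟨s, rfl⟩ j
    change x j ≤ x j + star (s j) * s j
    exact le_add_of_nonneg_right (star_mul_self_nonneg (s j))

end DirectSum

section SpectralOrder

variable {A : Type*} [CStarAlgebra A] [PartialOrder A]

variable (A) in
/-- The projection lattice `P(A)`, ordered as a subset of `A`. -/
abbrev Proj : Type _ := {p : A // IsStarProjection p}

/-- A bounded spectral family `(E l)`, `l` real, of projections: it is increasing, it satisfies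
`E l = ⋀_{u > l} E u` in the projection lattice, and it is `0` far to the left and `1` far to
the right. -/
structure IsSpectralFamily (E : ℝ → Proj A) : Prop where
  mono : ∀ l u : ℝ, l ≤ u → E l ≤ E u
  isGLB : ∀ l : ℝ, IsGLB (E '' Set.Ioi l) (E l)
  bounded : ∃ a : ℝ, 0 < a ∧ (∀ l, l < -a → (E l : A) = 0) ∧ (∀ l, a < l → (E l : A) = 1)

/-- `E` is the spectral family of the self-adjoint element `x`. -/
structure IsSpectralFamilyOf (E : ℝ → Proj A) (x : A) : Prop where
  isSelfAdjoint : IsSelfAdjoint x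
  isSpectralFamily : IsSpectralFamily E
  mul_le : ∀ l : ℝ, x * (E l : A) ≤ (l : ℂ) • (E l : A)
  le_mul : ∀ l : ℝ, (l : ℂ) • (1 - (E l : A)) ≤ x * (1 - (E l : A))

/-- The spectral order `x ⪯ y` of self-adjoint elements: `E^y_l ≤ E^x_l` for all real `l`. -/
def SpectralLE (x y : A) : Prop :=
  ∃ E F : ℝ → Proj A, IsSpectralFamilyOf E x ∧ IsSpectralFamilyOf F y ∧ ∀ l, F l ≤ E l

variable (A) in
/-- The effects of `A`: the positive elements of the closed unit ball. -/
def effects : Set A := {x | 0 ≤ x ∧ ‖x‖ ≤ 1}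

variable {B : Type*} [CStarAlgebra B] [PartialOrder B]

/-- A spectral order isomorphism between sets of self-adjoint elements: a bijection that preserves
the spectral order in both directions. -/
def IsSpectralOrderIso {S : Set A} {T : Set B} (φ : S → T) : Prop :=
  Function.Bijective φ ∧ ∀ x y : S, SpectralLE (x : A) (y : A) ↔ SpectralLE (φ x : B) (φ y : B)

/-- `IsTheta τ x y` says that `y = Θ_τ(x)`, that is, `y` is the self-adjoint element with spectral
family `E^y_l = τ (E^x_l)`, where `τ` is an isomorphism of projection lattices. -/
def IsTheta (τ : Proj A ≃o Proj B) (x : A) (y : B) : Prop :=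
  ∃ E : ℝ → Proj A, IsSpectralFamilyOf E x ∧ IsSpectralFamilyOf (fun l => τ (E l)) y

/-- `f(x)` for `f : [0,1] → [0,1]` and an effect `x`, by continuous functional calculus (the
spectrum of an effect lies in `[0,1]`, so the constant extension of `f` outside of `[0,1]`
plays no role). -/
def effectCalc (f : Set.Icc (0 : ℝ) 1 → Set.Icc (0 : ℝ) 1) (x : A) : A :=
  cfc (Set.IccExtend zero_le_one (fun t => (f t : ℝ))) x

end SpectralOrder

/-- The identification of `B(ℂᵐ)` with `B(ℂⁿ)` when `m = n`. -/
def MatAlg.cast {m n : ℕ} (h : m = n) (x : MatAlg m) : MatAlg n := h ▸ x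

end

/-!
An effect of a direct sum of matrix algebras has finite spectrum in each component, so it is encoded
by the family `specKer x l` of the kernels of its spectral projections: a decreasing function of `l`
with values in the product of the subspace lattices. In this encoding the spectral order is the
pointwise order, and the proof uses only the lattice-theoretic properties collected in
`IsLevelSystem`.

The elements whose lower set is a chain are zero and the effects `c • q` with `q` a rank-one
projection (`IsLevelSystem.exists_step_of_isLinearElt`). An isomorphism `Φ` permutes them, so
`Φ (c • q) = g q c • σ q` for a bijection `σ` of the atoms and increasing bijections `g q` of
`[0, 1]`. Every effect is the supremum of the effects `c • q` below it; hence `q` lies in the level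
of `x` at `l` if and only if `σ q` lies in the level of `Φ x` at `g q l`. Applied to projections,
this extends `σ` to an isomorphism `τ` of the subspace lattices. If `p`, `q`, `r` are three atoms on
a line, then every level that contains `p` and `r` contains `q`; for the effect which is `1` on `r`
and `c` on the rest of the line this yields `g p c ≤ g q c`, so `g p = g q` by symmetry
(`IsLevelSystem.exists_orderIso`).

Two different atoms of the product have a third atom on their line if and only if they lie in the
same factor. So `τ` permutes the factors, and `g` is constant on the atoms of each factor
(`IsLevelSystem.exists_decomposition`). The dimensions agree because they are the lengths of the
subspace lattices.

On the side of operators, spectral families are built by the continuous functional calculus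
(`isSpectralFamilyOf_specProj`), they are unique (`IsSpectralFamilyOf.eq_specProj`), and in direct
sums they are formed componentwise.
-/

noncomputable section

/-! ### Level systems and their isomorphisms -/

section LevelSystem

/-- The right-continuous step function on the line with value `⊤` on `(-∞, 0)`, `W` on
`[0, c)`, `W'` on `[c, 1)` and `⊥` on `[1, ∞)` (for `c` in `[0, 1]`). -/
def stepLevel {L : Type*} [CompleteLattice L] (W W' : L) (c l : ℝ) : L :=
  if l < 0 then ⊤ else if l < c then W else if l < 1 then W' else ⊥

/-- An abstract model of the effects with the spectral order: every `x : X` is encoded by the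
decreasing function `l ↦ V x l` into a lattice `L` (for an effect, the complement of its spectral
projection at `l`). The function is right-continuous as seen by the atoms of `L`, it
determines `x`, and all step functions with two steps inside `[0, 1]` occur. -/
structure IsLevelSystem {X L : Type*} [CompleteLattice L] (V : X → ℝ → L) : Prop where
  antitone : ∀ x, Antitone (V x)
  of_neg : ∀ x l, l < 0 → V x l = ⊤
  of_one_le : ∀ x l, 1 ≤ l → V x l = ⊥
  exists_gt : ∀ x l q, IsAtom q → q ≤ V x l → ∃ u, l < u ∧ q ≤ V x u
  injective : Function.Injective V
  exists_step : ∀ (W W' : L) (c : ℝ), W' ≤ W → 0 ≤ c → c ≤ 1 → ∃ x, V x = stepLevel W W' c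

variable {X Y L K : Type*} [CompleteLattice L] [CompleteLattice K]

theorem stepLevel_le_iff {f : ℝ → L} (hf : ∀ l, l < 0 → f l = ⊤) {q : L} {c : ℝ} :
    stepLevel q ⊥ c ≤ f ↔ ∀ l, 0 ≤ l → l < c → q ≤ f l := by
  constructor
  · intro h l h0 hc
    have := h l
    rwa [stepLevel, if_neg h0.not_gt, if_pos hc] at this
  · intro h l
    unfold stepLevel
    split_ifs with h1 h2 h3
    · rw [hf l h1]
    · exact h l (not_lt.1 h1) h2
    · exact bot_le
    · exact bot_le

theorem stepLevel_of_neg (W W' : L) (c : ℝ) {l : ℝ} (hl : l < 0) : stepLevel W W' c l = ⊤ :=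
  if_pos hl

theorem stepLevel_of_lt {W W' : L} {c l : ℝ} (h0 : 0 ≤ l) (hl : l < c) :
    stepLevel W W' c l = W := by
  rw [stepLevel, if_neg h0.not_gt, if_pos hl]

theorem stepLevel_of_ge {W W' : L} {c l : ℝ} (h0 : 0 ≤ l) (hl : c ≤ l) (h1 : l < 1) :
    stepLevel W W' c l = W' := by
  rw [stepLevel, if_neg h0.not_gt, if_neg hl.not_gt, if_pos h1]

theorem stepLevel_bot_of_ge {W : L} {c l : ℝ} (h0 : 0 ≤ l) (hl : c ≤ l) :
    stepLevel W ⊥ c l = ⊥ := by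
  rw [stepLevel, if_neg h0.not_gt, if_neg hl.not_gt, ite_self]

theorem stepLevel_le_stepLevel_iff {q : L} (hq : q ≠ ⊥) {c d : ℝ} (hd : 0 ≤ d) :
    stepLevel q ⊥ c ≤ stepLevel q ⊥ d ↔ c ≤ d := by
  rw [stepLevel_le_iff (fun l hl => stepLevel_of_neg _ _ _ hl)]
  constructor
  · intro h
    by_contra! hdc
    have := h d hd hdc
    rw [stepLevel_bot_of_ge hd le_rfl] at this
    exact hq (le_bot_iff.1 this)
  · intro h l h0 hl
    rw [stepLevel_of_lt h0 (hl.trans_le h)]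

theorem antitone_stepLevel {L : Type*} [CompleteLattice L] {W W' : L} (hW : W' ≤ W) {c : ℝ} :
    Antitone (stepLevel W W' c) := by
  intro l u hlu
  unfold stepLevel
  split_ifs <;> first | exact le_rfl | exact le_top | exact bot_le | exact hW | (exfalso; linarith)

theorem exists_gt_stepLevel_eq {L : Type*} [CompleteLattice L] (W W' : L) (c l : ℝ) :
    ∃ u, l < u ∧ stepLevel W W' c u = stepLevel W W' c l := by
  have h : ∀ a : ℝ, ∀ᶠ u in nhdsWithin l (Set.Ioi l), (u < a ↔ l < a) := by
    intro a
    by_cases hla : l < a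
    · exact (Filter.Eventually.filter_mono nhdsWithin_le_nhds (Iio_mem_nhds hla)).mono
        fun u hu => iff_of_true hu hla
    · filter_upwards [self_mem_nhdsWithin] with u hu
      exact iff_of_false (fun h => hla ((Set.mem_Ioi.1 hu).trans h)) hla
  obtain ⟨u, ⟨⟨h1, h2⟩, h3⟩, hu⟩ := (((h 0).and (h c)).and (h 1)).and self_mem_nhdsWithin |>.exists
  exact ⟨u, hu, by simp only [stepLevel, h1, h2, h3]⟩

theorem stepLevel_inj {q : L} (hq : q ≠ ⊥) {c d : Set.Icc (0 : ℝ) 1}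
    (h : stepLevel q ⊥ (c : ℝ) = stepLevel q ⊥ (d : ℝ)) : c = d :=
  le_antisymm ((stepLevel_le_stepLevel_iff hq d.2.1).1 h.le)
    ((stepLevel_le_stepLevel_iff hq c.2.1).1 h.ge)

theorem orderIso_Icc_zero (g : Set.Icc (0 : ℝ) 1 ≃o Set.Icc (0 : ℝ) 1) : g 0 = 0 :=
  le_antisymm ((g.monotone (g.symm 0).2.1).trans (g.apply_symm_apply 0).le) (g 0).2.1

theorem orderIso_Icc_one (g : Set.Icc (0 : ℝ) 1 ≃o Set.Icc (0 : ℝ) 1) : g 1 = 1 :=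
  le_antisymm (g 1).2.2 ((g.apply_symm_apply 1).ge.trans (g.monotone (g.symm 1).2.2))

/-- `x` is linear if the elements below `x` form a chain. -/
def IsLinearElt (V : X → ℝ → L) (x : X) : Prop :=
  ∀ y z, V y ≤ V x → V z ≤ V x → V y ≤ V z ∨ V z ≤ V y

namespace IsLevelSystem

variable {V : X → ℝ → L} {V' : Y → ℝ → K}

theorem level_zero_eq_bot_iff (hV : IsLevelSystem V) (x : X) :
    V x 0 = ⊥ ↔ ∀ y, V x ≤ V y := by
  constructor
  · intro h y l
    rcases lt_or_ge l 0 with hl | hl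
    · rw [hV.of_neg y l hl]
      exact le_top
    · exact ((hV.antitone x hl).trans h.le).trans bot_le
  · intro h
    obtain ⟨y, hy⟩ := hV.exists_step ⊥ ⊥ 0 le_rfl le_rfl zero_le_one
    have := h y 0
    rwa [hy, stepLevel_bot_of_ge le_rfl le_rfl, le_bot_iff] at this

/-- Below a one-step function at an atom every level in `[0, 1)` is `⊥` or the atom, so the elements
there are determined by where they jump. -/
theorem isLinearElt_of_step (hV : IsLevelSystem V) {x : X} {q : L} (hq : IsAtom q) {c : ℝ}
    (hx : V x = stepLevel q ⊥ c) : IsLinearElt V x := by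
  intro y z hy hz
  have key : ∀ w, V w ≤ V x → ∀ l, 0 ≤ l → V w l = ⊥ ∨ V w l = q := by
    intro w hw l hl
    refine hq.le_iff.1 ((hw l).trans ?_)
    rw [hx]
    rcases lt_or_ge l c with h | h
    · rw [stepLevel_of_lt hl h]
    · rw [stepLevel_bot_of_ge hl h]
      exact bot_le
  by_contra! h
  obtain ⟨l, hl⟩ := not_forall.1 h.1
  have hl0 : 0 ≤ l := by
    by_contra! hl0
    exact hl (by rw [hV.of_neg z l hl0]; exact le_top)
  have hyl : V y l = q := (key y hy l hl0).resolve_left fun h0 => hl (h0 ▸ bot_le)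
  have hzl : V z l = ⊥ := (key z hz l hl0).resolve_right fun h0 => hl (by rw [hyl, h0])
  refine h.2 fun u => ?_
  rcases lt_or_ge u 0 with hu0 | hu0
  · rw [hV.of_neg y u hu0]
    exact le_top
  rcases le_total u l with hu | hu
  · have h1 : V z u ≤ q := by
      rcases key z hz u hu0 with h0 | h0 <;> rw [h0]
      exact bot_le
    exact (h1.trans hyl.ge).trans (hV.antitone y hu)
  · exact ((hV.antitone z hu).trans hzl.le).trans bot_le

theorem step_le (hV : IsLevelSystem V) {x : X} {q : L} {c : ℝ} (h : q ≤ V x c) :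
    stepLevel q ⊥ c ≤ V x :=
  (stepLevel_le_iff (hV.of_neg x)).2 fun _ _ hl => h.trans (hV.antitone x hl.le)

/-- The linear elements are the bottom element and the one-step functions at atoms. -/
theorem exists_step_of_isLinearElt [IsAtomistic L] (hV : IsLevelSystem V) {x : X}
    (hx : IsLinearElt V x) :
    V x 0 = ⊥ ∨ ∃ q, IsAtom q ∧ ∃ c, 0 < c ∧ c ≤ 1 ∧ V x = stepLevel q ⊥ c := by
  rcases eq_bot_or_exists_atom_le (V x 0) with h0 | ⟨q, hq, hqx⟩
  · exact Or.inl h0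
  right
  have lt_one : ∀ p l, IsAtom p → p ≤ V x l → l < 1 := by
    intro p l hp h
    by_contra! hl
    rw [hV.of_one_le x l hl] at h
    exact hp.1 (le_bot_iff.1 h)
  -- two different atoms in the level at `0` would give incomparable elements below `x`
  have uniq : ∀ p, IsAtom p → p ≤ V x 0 → p = q := by
    intro p hp hpx
    obtain ⟨u, hu, hqu⟩ := hV.exists_gt x 0 q hq hqx
    obtain ⟨v, hv, hpv⟩ := hV.exists_gt x 0 p hp hpx
    obtain ⟨y, hy⟩ := hV.exists_step q ⊥ u bot_le hu.le (lt_one q u hq hqu).le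
    obtain ⟨z, hz⟩ := hV.exists_step p ⊥ v bot_le hv.le (lt_one p v hp hpv).le
    rcases hx y z (hy ▸ hV.step_le hqu) (hz ▸ hV.step_le hpv) with h | h
    · have := h 0
      rw [hy, hz, stepLevel_of_lt le_rfl hu, stepLevel_of_lt le_rfl hv] at this
      exact (hp.le_iff_eq hq.1).1 this |>.symm
    · have := h 0
      rw [hy, hz, stepLevel_of_lt le_rfl hu, stepLevel_of_lt le_rfl hv] at this
      exact (hq.le_iff_eq hp.1).1 this
  have hle : V x 0 ≤ q := le_iff_atom_le_imp.2 fun p hp hpx => (uniq p hp hpx).le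
  set S : Set ℝ := {l | q ≤ V x l} with hS
  have hbdd : BddAbove S := ⟨1, fun l hl => (lt_one q l hq hl).le⟩
  have h0S : (0 : ℝ) ∈ S := hqx
  have hlt : ∀ l, l < sSup S ↔ q ≤ V x l := by
    intro l
    constructor
    · intro h
      obtain ⟨u, hu, hlu⟩ := exists_lt_of_lt_csSup ⟨0, h0S⟩ h
      exact le_trans (show q ≤ V x u from hu) (hV.antitone x hlu.le)
    · intro h
      obtain ⟨u, hu, hqu⟩ := hV.exists_gt x l q hq h
      exact hu.trans_le (le_csSup hbdd hqu)
  refine ⟨q, hq, sSup S, (hlt 0).2 hqx, csSup_le ⟨0, h0S⟩ fun l hl => (lt_one q l hq hl).le, ?_⟩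
  funext l
  rcases lt_or_ge l 0 with hl | hl
  · rw [hV.of_neg x l hl, stepLevel_of_neg _ _ _ hl]
  have hlq : V x l ≤ q := (hV.antitone x hl).trans hle
  rcases lt_or_ge l (sSup S) with h | h
  · rw [stepLevel_of_lt hl h]
    exact le_antisymm hlq ((hlt l).1 h)
  · rw [stepLevel_bot_of_ge hl h]
    refine (hq.le_iff.1 hlq).resolve_right fun h' => h.not_gt ((hlt l).2 h'.ge)

theorem exists_step_of_le [IsAtomistic L] (hV : IsLevelSystem V) {x : X} {q : L} (hq : IsAtom q)
    (hx : V x ≤ stepLevel q ⊥ 1) : ∃ c : Set.Icc (0 : ℝ) 1, V x = stepLevel q ⊥ c := by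
  obtain ⟨x₁, hx₁⟩ := hV.exists_step q ⊥ 1 bot_le zero_le_one le_rfl
  have hlin := hV.isLinearElt_of_step hq hx₁
  rw [← hx₁] at hx
  rcases hV.exists_step_of_isLinearElt
    (fun y z hy hz => hlin y z (hy.trans hx) (hz.trans hx)) with h | ⟨p, hp, c, hc0, hc1, h⟩
  · refine ⟨⟨0, le_rfl, zero_le_one⟩, ?_⟩
    obtain ⟨x₀, hx₀⟩ := hV.exists_step q ⊥ 0 bot_le le_rfl zero_le_one
    have h2 : V x₀ 0 = ⊥ := by rw [hx₀, stepLevel_bot_of_ge le_rfl le_rfl]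
    rw [← hx₀]
    exact le_antisymm ((hV.level_zero_eq_bot_iff x).1 h x₀) ((hV.level_zero_eq_bot_iff x₀).1 h2 x)
  · have := hx 0
    rw [h, hx₁, stepLevel_of_lt le_rfl hc0, stepLevel_of_lt le_rfl one_pos] at this
    obtain rfl := (hq.le_iff_eq hp.1).1 this
    exact ⟨⟨c, hc0.le, hc1⟩, h⟩

theorem isLinearElt_map (Φ : X ≃ Y) (hΦ : ∀ x y, V x ≤ V y ↔ V' (Φ x) ≤ V' (Φ y)) {x : X}
    (hx : IsLinearElt V x) : IsLinearElt V' (Φ x) := by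
  intro y z hy hz
  obtain ⟨y, rfl⟩ := Φ.surjective y
  obtain ⟨z, rfl⟩ := Φ.surjective z
  rw [← hΦ] at hy hz ⊢
  rw [← hΦ]
  exact hx y z hy hz

theorem symm_le_iff {Φ : X ≃ Y} (hΦ : ∀ x y, V x ≤ V y ↔ V' (Φ x) ≤ V' (Φ y)) (x y : Y) :
    V' x ≤ V' y ↔ V (Φ.symm x) ≤ V (Φ.symm y) := by
  rw [hΦ, Φ.apply_symm_apply, Φ.apply_symm_apply]

/-- As `q ≤ V x l` says that some one-step function at `q` with jump beyond `l` lies below `x`, the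
action of an isomorphism on one-step functions determines how it moves the levels. -/
theorem le_level_map (hV : IsLevelSystem V) (Φ : X ≃ Y)
    (hΦ : ∀ x y, V x ≤ V y ↔ V' (Φ x) ≤ V' (Φ y)) {q : L} {q' : K} (hq : IsAtom q)
    (g : Set.Icc (0 : ℝ) 1 ≃o Set.Icc (0 : ℝ) 1)
    (hg : ∀ x (c : Set.Icc (0 : ℝ) 1), V x = stepLevel q ⊥ c → V' (Φ x) = stepLevel q' ⊥ (g c))
    (x : X) (l : Set.Icc (0 : ℝ) 1) (h : q ≤ V x l) : q' ≤ V' (Φ x) (g l) := by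
  obtain ⟨u, hlu, hu⟩ := hV.exists_gt x l q hq h
  have hu1 : u ≤ 1 := by
    by_contra! h1
    rw [hV.of_one_le x u h1.le] at hu
    exact hq.1 (le_bot_iff.1 hu)
  have hu0 : 0 ≤ u := l.2.1.trans hlu.le
  obtain ⟨y, hy⟩ := hV.exists_step q ⊥ u bot_le hu0 hu1
  have hyx : V y ≤ V x := hy ▸ hV.step_le hu
  have h2 := (hΦ y x).1 hyx (g l)
  rwa [hg y ⟨u, hu0, hu1⟩ hy, stepLevel_of_lt (g l).2.1 ?_] at h2
  exact g.lt_iff_lt.2 hlu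

variable [IsAtomistic L] [IsAtomistic K]

/-- The one-step functions at an atom with jump at `1` are the maximal linear elements, hence
they are permuted. -/
theorem exists_map_step_one (hV : IsLevelSystem V) (hV' : IsLevelSystem V') (Φ : X ≃ Y)
    (hΦ : ∀ x y, V x ≤ V y ↔ V' (Φ x) ≤ V' (Φ y)) {q : L} (hq : IsAtom q) {x : X}
    (hx : V x = stepLevel q ⊥ 1) : ∃ q', IsAtom q' ∧ V' (Φ x) = stepLevel q' ⊥ 1 := by
  have hlin := isLinearElt_map Φ hΦ (hV.isLinearElt_of_step hq hx)
  rcases hV'.exists_step_of_isLinearElt hlin with h | ⟨q', hq', c, hc0, hc1, h⟩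
  · exfalso
    have : V x 0 = ⊥ := (hV.level_zero_eq_bot_iff x).2 fun y =>
      (hΦ x y).2 ((hV'.level_zero_eq_bot_iff _).1 h _)
    rw [hx, stepLevel_of_lt le_rfl one_pos] at this
    exact hq.1 this
  · refine ⟨q', hq', ?_⟩
    obtain ⟨y, hy⟩ := hV'.exists_step q' ⊥ 1 bot_le zero_le_one le_rfl
    have hlin' := isLinearElt_map Φ.symm (symm_le_iff hΦ)
      (hV'.isLinearElt_of_step hq' hy)
    have hle : V x ≤ V (Φ.symm y) := by
      rw [hΦ, Φ.apply_symm_apply, h, hy, stepLevel_le_stepLevel_iff hq'.1 zero_le_one]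
      exact hc1
    have hq0 : q ≤ V (Φ.symm y) 0 := by
      have := hle 0
      rwa [hx, stepLevel_of_lt le_rfl one_pos] at this
    rcases hV.exists_step_of_isLinearElt hlin' with h0 | ⟨p, hp, d, hd0, hd1, hd⟩
    · exact absurd (le_bot_iff.1 (h0 ▸ hq0)) hq.1
    · rw [hd, stepLevel_of_lt le_rfl hd0] at hq0
      obtain rfl := (hp.le_iff_eq hq.1).1 hq0
      have h1 : V (Φ.symm y) ≤ V x := by
        rw [hd, hx, stepLevel_le_stepLevel_iff hq.1 zero_le_one]
        exact hd1
      have : Φ.symm y = x := hV.injective (le_antisymm h1 hle)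
      rw [← this, Φ.apply_symm_apply, hy]

/-- An isomorphism maps the chain of one-step functions at an atom onto another such chain. -/
theorem exists_map_step (hV : IsLevelSystem V) (hV' : IsLevelSystem V') (Φ : X ≃ Y)
    (hΦ : ∀ x y, V x ≤ V y ↔ V' (Φ x) ≤ V' (Φ y)) {q : L} (hq : IsAtom q) :
    ∃ q', IsAtom q' ∧ ∃ g : Set.Icc (0 : ℝ) 1 ≃o Set.Icc (0 : ℝ) 1,
      ∀ x (c : Set.Icc (0 : ℝ) 1), V x = stepLevel q ⊥ c → V' (Φ x) = stepLevel q' ⊥ (g c) := by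
  obtain ⟨x₁, hx₁⟩ := hV.exists_step q ⊥ 1 bot_le zero_le_one le_rfl
  obtain ⟨q', hq', hy₁⟩ := exists_map_step_one hV hV' Φ hΦ hq hx₁
  have h1 : ∀ c : Set.Icc (0 : ℝ) 1, ∃ d : Set.Icc (0 : ℝ) 1,
      ∀ x, V x = stepLevel q ⊥ c → V' (Φ x) = stepLevel q' ⊥ d := by
    intro c
    obtain ⟨x, hx⟩ := hV.exists_step q ⊥ c bot_le c.2.1 c.2.2
    have : V' (Φ x) ≤ stepLevel q' ⊥ 1 := by
      rw [← hy₁, ← hΦ, hx, hx₁, stepLevel_le_stepLevel_iff hq.1 zero_le_one]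
      exact c.2.2
    obtain ⟨d, hd⟩ := hV'.exists_step_of_le hq' this
    refine ⟨d, fun z hz => ?_⟩
    rw [hV.injective (hz.trans hx.symm), hd]
  have h2 : ∀ d : Set.Icc (0 : ℝ) 1, ∃ c : Set.Icc (0 : ℝ) 1,
      ∀ y, V' y = stepLevel q' ⊥ d → V (Φ.symm y) = stepLevel q ⊥ c := by
    intro d
    obtain ⟨y, hy⟩ := hV'.exists_step q' ⊥ d bot_le d.2.1 d.2.2
    have : V (Φ.symm y) ≤ stepLevel q ⊥ 1 := by
      rw [← hx₁, hΦ, Φ.apply_symm_apply, hy, hy₁, stepLevel_le_stepLevel_iff hq'.1 zero_le_one]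
      exact d.2.2
    obtain ⟨c, hc⟩ := hV.exists_step_of_le hq this
    refine ⟨c, fun z hz => ?_⟩
    rw [hV'.injective (hz.trans hy.symm), hc]
  choose g hg using h1
  choose g' hg' using h2
  refine ⟨q', hq', ⟨⟨g, g', fun c => ?_, fun d => ?_⟩, fun {c d} => ?_⟩, fun x c => hg c x⟩
  · obtain ⟨x, hx⟩ := hV.exists_step q ⊥ c bot_le c.2.1 c.2.2
    have := hg' _ _ (hg c x hx)
    rw [Φ.symm_apply_apply, hx] at this
    exact (stepLevel_inj hq.1 this).symm
  · obtain ⟨y, hy⟩ := hV'.exists_step q' ⊥ d bot_le d.2.1 d.2.2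
    have := hg _ _ (hg' d y hy)
    rw [Φ.apply_symm_apply, hy] at this
    exact (stepLevel_inj hq'.1 this).symm
  · obtain ⟨x, hx⟩ := hV.exists_step q ⊥ c bot_le c.2.1 c.2.2
    obtain ⟨y, hy⟩ := hV.exists_step q ⊥ d bot_le d.2.1 d.2.2
    change g c ≤ g d ↔ c ≤ d
    rw [← Subtype.coe_le_coe, ← Subtype.coe_le_coe,
      ← stepLevel_le_stepLevel_iff hq'.1 (g d).2.1, ← stepLevel_le_stepLevel_iff hq.1 d.2.1,
      ← hg c x hx, ← hg d y hy, ← hx, ← hy, ← hΦ]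

/-- An isomorphism of level systems is induced by an isomorphism `τ` of the lattices, combined with
changes of scale `g q` of `[0, 1]` that may depend on the atom `q`. Two atoms with a third one on
the line through them have the same change of scale. -/
theorem exists_orderIso (hV : IsLevelSystem V) (hV' : IsLevelSystem V') (Φ : X ≃ Y)
    (hΦ : ∀ x y, V x ≤ V y ↔ V' (Φ x) ≤ V' (Φ y)) :
    ∃ (τ : L ≃o K) (g : L → (Set.Icc (0 : ℝ) 1 ≃o Set.Icc (0 : ℝ) 1)),
      (∀ q, IsAtom q → ∀ x (l : Set.Icc (0 : ℝ) 1), q ≤ V x l ↔ τ q ≤ V' (Φ x) (g q l)) ∧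
      ∀ p q r, IsAtom p → IsAtom q → IsAtom r → p ≠ r → q ≠ r → p ≤ q ⊔ r → q ≤ p ⊔ r →
        g p = g q := by
  -- the values of `σ` and `g` at elements that are not atoms are irrelevant
  have hex : ∀ q : L, ∃ q' : K, ∃ g : Set.Icc (0 : ℝ) 1 ≃o Set.Icc (0 : ℝ) 1, IsAtom q →
      IsAtom q' ∧ ∀ x (c : Set.Icc (0 : ℝ) 1),
        V x = stepLevel q ⊥ c → V' (Φ x) = stepLevel q' ⊥ (g c) := by
    intro q
    by_cases hq : IsAtom q
    · obtain ⟨q', hq', g, hg⟩ := exists_map_step hV hV' Φ hΦ hq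
      exact ⟨q', g, fun _ => ⟨hq', hg⟩⟩
    · exact ⟨⊥, OrderIso.refl _, fun h => absurd h hq⟩
  choose σ g hσ using hex
  have hgs : ∀ q, IsAtom q → ∀ y (c : Set.Icc (0 : ℝ) 1),
      V' y = stepLevel (σ q) ⊥ c → V (Φ.symm y) = stepLevel q ⊥ ((g q).symm c) := by
    intro q hq y c hy
    obtain ⟨x, hx⟩ := hV.exists_step q ⊥ ((g q).symm c) bot_le ((g q).symm c).2.1
      ((g q).symm c).2.2
    have := (hσ q hq).2 x _ hx
    rw [OrderIso.apply_symm_apply] at this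
    rw [← hx, hV'.injective (hy.trans this.symm), Φ.symm_apply_apply]
  have key : ∀ q, IsAtom q → ∀ x (l : Set.Icc (0 : ℝ) 1),
      q ≤ V x l ↔ σ q ≤ V' (Φ x) (g q l) := by
    intro q hq x l
    refine ⟨le_level_map hV Φ hΦ hq (g q) (hσ q hq).2 x l, fun h => ?_⟩
    have := le_level_map hV' Φ.symm (symm_le_iff hΦ) (hσ q hq).1 (g q).symm (hgs q hq) _ _ h
    rwa [Φ.symm_apply_apply, OrderIso.symm_apply_apply] at this
  have surj : ∀ q', IsAtom q' → ∃ q, IsAtom q ∧ σ q = q' := by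
    intro q' hq'
    obtain ⟨y, hy⟩ := hV'.exists_step q' ⊥ 1 bot_le zero_le_one le_rfl
    obtain ⟨q, hq, hx⟩ := exists_map_step_one hV' hV Φ.symm (symm_le_iff hΦ) hq' hy
    refine ⟨q, hq, ?_⟩
    have := (hσ q hq).2 _ 1 hx
    rw [Φ.apply_symm_apply, orderIso_Icc_one, hy] at this
    have h0 := congrFun this 0
    rw [stepLevel_of_lt le_rfl one_pos] at h0
    rw [h0]
    exact (stepLevel_of_lt le_rfl one_pos).symm
  -- the functions that are constant on `[0, 1)` model the projections, a copy of the lattice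
  choose e he using fun W : L => hV.exists_step W W 1 le_rfl zero_le_one le_rfl
  have he0 : ∀ W, V (e W) 0 = W := fun W => by rw [he, stepLevel_of_lt le_rfl one_pos]
  choose e' he' using fun W : K => hV'.exists_step W W 1 le_rfl zero_le_one le_rfl
  have atom_iff : ∀ q, IsAtom q → ∀ W, q ≤ W ↔ σ q ≤ V' (Φ (e W)) 0 := by
    intro q hq W
    have := key q hq (e W) 0
    rwa [orderIso_Icc_zero, Set.Icc.coe_zero, he0] at this
  let τ₀ : L ↪o K := OrderEmbedding.ofMapLEIff (fun W => V' (Φ (e W)) 0) (by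
    intro W W'
    rw [le_iff_atom_le_imp, le_iff_atom_le_imp]
    constructor
    · intro h q hq hqW
      exact (atom_iff q hq W').2 (h _ (hσ q hq).1 ((atom_iff q hq W).1 hqW))
    · intro h q' hq' hqW
      obtain ⟨q, hq, rfl⟩ := surj q' hq'
      exact (atom_iff q hq W').1 (h _ hq ((atom_iff q hq W).2 hqW)))
  have hτ₀ : ∀ q, IsAtom q → ∀ W, q ≤ W ↔ σ q ≤ τ₀ W := atom_iff
  have hsurj : Function.Surjective τ₀ := by
    intro W'
    refine ⟨V (Φ.symm (e' W')) 0, ?_⟩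
    refine eq_iff_atom_le_iff.2 fun q' hq' => ?_
    obtain ⟨q, hq, rfl⟩ := surj q' hq'
    have h1 := key q hq (Φ.symm (e' W')) 0
    rw [orderIso_Icc_zero, Φ.apply_symm_apply, Set.Icc.coe_zero, he',
      stepLevel_of_lt le_rfl one_pos] at h1
    rw [← hτ₀ q hq, h1]
  let τ : L ≃o K := RelIso.ofSurjective τ₀ hsurj
  have hτ : ∀ q, IsAtom q → τ q = σ q := by
    intro q hq
    have h1 : σ q ≤ τ q := (hτ₀ q hq q).1 le_rfl
    have h2 : IsAtom (τ q) := (OrderIso.isAtom_iff τ q).2 hq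
    exact ((h2.le_iff_eq (hσ q hq).1.1).1 h1).symm
  have key' : ∀ q, IsAtom q → ∀ x (l : Set.Icc (0 : ℝ) 1),
      q ≤ V x l ↔ τ q ≤ V' (Φ x) (g q l) := by
    intro q hq x l
    rw [hτ q hq, key q hq]
  -- compare the images of the effect with value `1` on `r` and `c` on the rest of the line
  have mono_g : ∀ p q r, IsAtom p → IsAtom q → IsAtom r → p ≠ r → q ≠ r → q ≤ p ⊔ r →
      ∀ c, g p c ≤ g q c := by
    intro p q r hp hq hr hpr hqr hle c
    obtain ⟨x, hx⟩ := hV.exists_step (p ⊔ r) r c le_sup_right c.2.1 c.2.2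
    by_contra! hlt
    have hc1 : g q c < 1 := lt_of_lt_of_le hlt (g p c).2.2
    have h1 : τ p ≤ V' (Φ x) (g q c) := by
      obtain ⟨l, hl⟩ := (g p).surjective (g q c)
      rw [← hl] at hlt ⊢
      rw [← key' p hp, hx, stepLevel_of_lt l.2.1 ((g p).lt_iff_lt.1 hlt)]
      exact le_sup_left
    have h2 : τ r ≤ V' (Φ x) (g q c) := by
      obtain ⟨l, hl⟩ := (g r).surjective (g q c)
      rw [← hl] at hc1 ⊢
      rw [← key' r hr, hx]
      have hl1 : (l : ℝ) < 1 := by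
        rw [← orderIso_Icc_one (g r)] at hc1
        exact (g r).lt_iff_lt.1 hc1
      rcases lt_or_ge (l : ℝ) c with h | h
      · rw [stepLevel_of_lt l.2.1 h]
        exact le_sup_right
      · rw [stepLevel_of_ge l.2.1 h hl1]
    have h3 : τ q ≤ V' (Φ x) (g q c) := by
      refine ((OrderIso.le_iff_le τ).2 hle).trans ?_
      rw [map_sup]
      exact sup_le h1 h2
    rw [← key' q hq, hx] at h3
    have hc1' : (c : ℝ) < 1 := by
      rw [← orderIso_Icc_one (g q)] at hc1
      exact (g q).lt_iff_lt.1 hc1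
    rw [stepLevel_of_ge c.2.1 le_rfl hc1'] at h3
    exact hqr ((hr.le_iff_eq hq.1).1 h3)
  refine ⟨τ, g, key', fun p q r hp hq hr hpr hqr h1 h2 => ?_⟩
  ext c
  exact le_antisymm (mono_g p q r hp hq hr hpr hqr h2 c) (mono_g q p r hq hp hr hqr hpr h1 c)

end IsLevelSystem

end LevelSystem

/-! ### Isomorphisms between products of irreducible lattices -/

section PiLattice

/-- Two atoms are perspective if a third atom lies with them on a line. -/
def AtomsPerspective {L : Type*} [Lattice L] [OrderBot L] (p q : L) : Prop :=
  ∃ r, IsAtom r ∧ p ≠ r ∧ q ≠ r ∧ p ≤ q ⊔ r ∧ q ≤ p ⊔ r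

theorem AtomsPerspective.map {L K : Type*} [Lattice L] [OrderBot L] [Lattice K] [OrderBot K]
    (τ : L ≃o K) {p q : L} (h : AtomsPerspective p q) : AtomsPerspective (τ p) (τ q) := by
  obtain ⟨r, hr, h1, h2, h3, h4⟩ := h
  refine ⟨τ r, (OrderIso.isAtom_iff τ r).2 hr, τ.injective.ne h1, τ.injective.ne h2, ?_, ?_⟩
  · rwa [← map_sup, τ.le_iff_le]
  · rwa [← map_sup, τ.le_iff_le]

open Classical in
/-- The element of a product with the single nontrivial component `a` at the index `j`. -/
def piSingleBot {ι : Type*} {L : ι → Type*} [∀ j, CompleteLattice (L j)] (j : ι) (a : L j) :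
    ∀ j, L j :=
  Function.update ⊥ j a

variable {Λ Γ : Type*} {L : Λ → Type*} {K : Γ → Type*} [∀ j, CompleteLattice (L j)]
  [∀ k, CompleteLattice (K k)]

@[simp]
theorem piSingleBot_same (j : Λ) (a : L j) : piSingleBot j a j = a := by
  simp [piSingleBot]

theorem piSingleBot_of_ne {i j : Λ} (h : i ≠ j) (a : L j) : piSingleBot j a i = ⊥ := by
  simp [piSingleBot, h]

theorem piSingleBot_le_iff {j : Λ} {a : L j} {f : ∀ j, L j} : piSingleBot j a ≤ f ↔ a ≤ f j := by
  constructor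
  · intro h
    simpa using h j
  · intro h i
    rcases eq_or_ne i j with rfl | hi
    · simpa using h
    · rw [piSingleBot_of_ne hi]
      exact bot_le

theorem piSingleBot_injective (j : Λ) : Function.Injective (piSingleBot j : L j → ∀ j, L j) := by
  intro a b h
  simpa using congrFun h j

theorem index_eq_of_piSingleBot_eq {i j : Λ} {a : L i} {b : L j} (ha : a ≠ ⊥)
    (h : piSingleBot i a = piSingleBot j b) : i = j := by
  by_contra hij
  have := congrFun h i
  rw [piSingleBot_same, piSingleBot_of_ne hij] at this
  exact ha this

theorem isAtom_piSingleBot {j : Λ} {a : L j} (ha : IsAtom a) : IsAtom (piSingleBot j a) :=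
  Pi.isAtom_iff.2 ⟨j, by simpa, fun _ h => piSingleBot_of_ne h a⟩

theorem exists_eq_piSingleBot {q : ∀ j, L j} (hq : IsAtom q) :
    ∃ j, ∃ a : L j, IsAtom a ∧ q = piSingleBot j a := by
  obtain ⟨j, hj, h⟩ := Pi.isAtom_iff.1 hq
  refine ⟨j, q j, hj, funext fun i => ?_⟩
  rcases eq_or_ne i j with rfl | hi
  · rw [piSingleBot_same]
  · rw [h i hi, piSingleBot_of_ne hi]

theorem AtomsPerspective.piSingleBot {j : Λ} {a b : L j} (h : AtomsPerspective a b) :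
    AtomsPerspective (piSingleBot j a) (piSingleBot j b) := by
  obtain ⟨r, hr, h1, h2, h3, h4⟩ := h
  refine ⟨_root_.piSingleBot j r, isAtom_piSingleBot hr, (piSingleBot_injective j).ne h1,
    (piSingleBot_injective j).ne h2, ?_, ?_⟩ <;> simpa [piSingleBot_le_iff]

theorem index_eq_of_atomsPerspective {i j : Λ} {a : L i} {b : L j} (ha : IsAtom a)
    (h : AtomsPerspective (piSingleBot i a) (piSingleBot j b)) : i = j := by
  obtain ⟨r, hr, h1, -, h3, -⟩ := h
  by_contra hij
  rw [piSingleBot_le_iff, Pi.sup_apply, piSingleBot_of_ne hij, bot_sup_eq,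
    ← piSingleBot_le_iff] at h3
  exact h1 ((hr.le_iff_eq (isAtom_piSingleBot ha).1).1 h3)

variable [∀ j, IsAtomistic (L j)] [∀ k, IsAtomistic (K k)]
  [∀ j, Nontrivial (L j)]

/-- Perspective atoms of a product lie in the same factor, so an isomorphism maps all atoms of a factor
with pairwise perspective atoms into one factor. -/
theorem exists_index_map_piSingleBot
    (hL : ∀ j, ∀ a b : L j, IsAtom a → IsAtom b → a ≠ b → AtomsPerspective a b)
    (τ : (∀ j, L j) ≃o (∀ k, K k)) (j : Λ) :
    ∃ k, ∀ a : L j, ∃ b : K k, τ (piSingleBot j a) = piSingleBot k b := by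
  obtain ⟨a₀, ha₀, -⟩ := (eq_bot_or_exists_atom_le (⊤ : L j)).resolve_left top_ne_bot
  have hatom : ∀ a : L j, IsAtom a → IsAtom (τ (piSingleBot j a)) := fun a ha =>
    (OrderIso.isAtom_iff τ _).2 (isAtom_piSingleBot ha)
  obtain ⟨k, b₀, hb₀, hk⟩ := exists_eq_piSingleBot (hatom a₀ ha₀)
  have key : ∀ a : L j, IsAtom a → ∃ b : K k, τ (piSingleBot j a) = piSingleBot k b := by
    intro a ha
    rcases eq_or_ne a₀ a with rfl | hne
    · exact ⟨b₀, hk⟩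
    · obtain ⟨k', b, -, hb⟩ := exists_eq_piSingleBot (hatom a ha)
      have := (hL j a₀ a ha₀ ha hne).piSingleBot.map τ
      rw [hk, hb] at this
      obtain rfl := index_eq_of_atomsPerspective hb₀ this
      exact ⟨b, hb⟩
  refine ⟨k, fun W => ⟨τ (piSingleBot j W) k, ?_⟩⟩
  refine le_antisymm (le_iff_atom_le_imp.2 fun q' hq' hle => ?_) (piSingleBot_le_iff.2 le_rfl)
  obtain ⟨q, rfl⟩ := τ.surjective q'
  have hq := (OrderIso.isAtom_iff τ _).1 hq'
  rw [τ.le_iff_le] at hle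
  obtain ⟨i, a, ha, rfl⟩ := exists_eq_piSingleBot hq
  have hij : i = j := by
    by_contra hij
    rw [piSingleBot_le_iff, piSingleBot_of_ne hij] at hle
    exact ha.1 (le_bot_iff.1 hle)
  subst hij
  obtain ⟨b, hb⟩ := key a ha
  rw [← τ.le_iff_le, hb, piSingleBot_le_iff] at hle
  rw [hb]
  exact piSingleBot_le_iff.2 (by simpa using hle)

variable [∀ k, Nontrivial (K k)]

/-- An isomorphism between products of irreducible lattices permutes the factors. -/
theorem exists_equiv_map_piSingleBot
    (hL : ∀ j, ∀ a b : L j, IsAtom a → IsAtom b → a ≠ b → AtomsPerspective a b)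
    (hK : ∀ k, ∀ a b : K k, IsAtom a → IsAtom b → a ≠ b → AtomsPerspective a b)
    (τ : (∀ j, L j) ≃o (∀ k, K k)) :
    ∃ (π : Γ ≃ Λ) (t : ∀ k, L (π k) ≃o K k),
      ∀ k a, τ (piSingleBot (π k) a) = piSingleBot k (t k a) := by
  choose φ hφ using exists_index_map_piSingleBot hL τ
  choose ψ hψ using exists_index_map_piSingleBot hK τ.symm
  have h1 : ∀ j, ψ (φ j) = j := by
    intro j
    obtain ⟨b, hb⟩ := hφ j ⊤
    obtain ⟨a, ha⟩ := hψ (φ j) b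
    rw [← hb, τ.symm_apply_apply] at ha
    exact (index_eq_of_piSingleBot_eq top_ne_bot ha).symm
  have h2 : ∀ k, φ (ψ k) = k := by
    intro k
    obtain ⟨a, ha⟩ := hψ k ⊤
    obtain ⟨b, hb⟩ := hφ (ψ k) a
    rw [← ha, τ.apply_symm_apply] at hb
    exact (index_eq_of_piSingleBot_eq top_ne_bot hb).symm
  have h3 : ∀ k, ∀ a : L (ψ k), ∃ b : K k, τ (piSingleBot (ψ k) a) = piSingleBot k b := by
    intro k a
    have := hφ (ψ k) a
    rwa [h2] at this
  choose t ht using h3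
  choose t' ht' using hψ
  refine ⟨⟨ψ, φ, h2, h1⟩, fun k => ⟨⟨t k, t' k, fun a => ?_, fun b => ?_⟩, fun {a b} => ?_⟩, ht⟩
  · have := ht' k (t k a)
    rw [← ht, τ.symm_apply_apply] at this
    exact (piSingleBot_injective _ this).symm
  · have := ht k (t' k b)
    rw [← ht', τ.apply_symm_apply] at this
    exact (piSingleBot_injective _ this).symm
  · change t k a ≤ t k b ↔ a ≤ b
    have h4 : ∀ c d : K k, c ≤ d ↔ piSingleBot k c ≤ piSingleBot k d := fun c d => by
      rw [piSingleBot_le_iff, piSingleBot_same]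
    rw [h4, ← ht, ← ht, τ.le_iff_le, piSingleBot_le_iff, piSingleBot_same]

/-- An isomorphism of level systems over products of irreducible lattices permutes the factors, and
acts on each factor as a lattice isomorphism combined with one change of scale of `[0, 1]`. -/
theorem IsLevelSystem.exists_decomposition {X Y : Type*}
    (hL : ∀ j, ∀ a b : L j, IsAtom a → IsAtom b → a ≠ b → AtomsPerspective a b)
    (hK : ∀ k, ∀ a b : K k, IsAtom a → IsAtom b → a ≠ b → AtomsPerspective a b)
    {V : X → ℝ → ∀ j, L j} {V' : Y → ℝ → ∀ k, K k}
    (hV : IsLevelSystem V) (hV' : IsLevelSystem V') (Φ : X ≃ Y)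
    (hΦ : ∀ x y, V x ≤ V y ↔ V' (Φ x) ≤ V' (Φ y)) :
    ∃ (π : Γ ≃ Λ) (t : ∀ k, L (π k) ≃o K k)
      (f : Λ → (Set.Icc (0 : ℝ) 1 ≃o Set.Icc (0 : ℝ) 1)),
      ∀ x k (l : Set.Icc (0 : ℝ) 1), V' (Φ x) (f (π k) l) k = t k (V x l (π k)) := by
  obtain ⟨τ, g, hτ, hg⟩ := exists_orderIso hV hV' Φ hΦ
  obtain ⟨π, t, ht⟩ := exists_equiv_map_piSingleBot hL hK τ
  choose a₀ ha₀ using fun j =>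
    (eq_bot_or_exists_atom_le (⊤ : L j)).resolve_left top_ne_bot
  have hgf : ∀ j (a : L j), IsAtom a → g (piSingleBot j a) = g (piSingleBot j (a₀ j)) := by
    intro j a ha
    rcases eq_or_ne a (a₀ j) with rfl | hne
    · rfl
    · obtain ⟨r, hr, h1, h2, h3, h4⟩ := (hL j a (a₀ j) ha (ha₀ j).1 hne).piSingleBot
      exact hg _ _ r (isAtom_piSingleBot ha) (isAtom_piSingleBot (ha₀ j).1) hr h1 h2 h3 h4
  refine ⟨π, t, fun j => g (piSingleBot j (a₀ j)), fun x k l => ?_⟩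
  refine eq_iff_atom_le_iff.2 fun b hb => ?_
  obtain ⟨a, rfl⟩ := (t k).surjective b
  have ha := (OrderIso.isAtom_iff (t k) a).1 hb
  dsimp only
  rw [(t k).le_iff_le, ← piSingleBot_le_iff, ← ht, ← hgf _ a ha, ← hτ _ (isAtom_piSingleBot ha),
    piSingleBot_le_iff]

end PiLattice

/-! ### Spectral families of elements with finite spectrum -/

section SpectralProjection

variable {A : Type*} [CStarAlgebra A]

theorem isStarProjection_cfc_indicator (x : A) (l : ℝ) :
    IsStarProjection (cfc (fun t : ℝ => if t ≤ l then (1 : ℝ) else 0) x) := by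
  refine ⟨?_, cfc_predicate _ _⟩
  by_cases h : ContinuousOn (fun t : ℝ => if t ≤ l then (1 : ℝ) else 0) (spectrum ℝ x)
  · rw [IsIdempotentElem, ← cfc_mul _ _ x h h]
    congr 1
    funext t
    split_ifs <;> simp
  · rw [cfc_apply_of_not_continuousOn _ h]
    exact mul_zero 0

/-- The spectral projection of `x` for the half-line `(-∞, l]`. The indicator function of the
half-line is continuous on the spectrum whenever the spectrum is finite; only this case is
meaningful, since the continuous functional calculus is `0` otherwise. -/
def specProj (x : A) (l : ℝ) : Proj A :=
  ⟨cfc (fun t : ℝ => if t ≤ l then (1 : ℝ) else 0) x, isStarProjection_cfc_indicator x l⟩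

theorem specProj_eq_of_forall {x : A} {l u : ℝ} (h : ∀ t ∈ spectrum ℝ x, t ≤ l ↔ t ≤ u) :
    specProj x l = specProj x u :=
  Subtype.ext (cfc_congr fun t ht => by simp only [h t ht])

theorem exists_gt_specProj_eq {x : A} (hx : (spectrum ℝ x).Finite) (l : ℝ) :
    ∃ u, l < u ∧ specProj x u = specProj x l := by
  have h : ∀ᶠ u in nhdsWithin l (Set.Ioi l), ∀ t ∈ spectrum ℝ x, l < t → u < t := by
    rw [Filter.eventually_all_finite hx]
    intro t _
    by_cases hlt : l < t
    · exact (Filter.Eventually.filter_mono nhdsWithin_le_nhds (Iio_mem_nhds hlt)).mono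
        fun u hu _ => hu
    · exact Filter.Eventually.of_forall fun u h => absurd h hlt
  obtain ⟨u, hu, hlu⟩ := (h.and self_mem_nhdsWithin).exists
  refine ⟨u, hlu, specProj_eq_of_forall fun t ht => ⟨fun htu => ?_, fun htl => htl.trans hlu.le⟩⟩
  by_contra! hlt
  exact (hu t ht hlt).not_ge htu

/-- An element with finite spectrum is determined by its spectral projections. -/
theorem eq_of_specProj_eq {x y : A} (hx : IsSelfAdjoint x) (hy : IsSelfAdjoint y)
    (hxf : (spectrum ℝ x).Finite) (hyf : (spectrum ℝ y).Finite)
    (h : ∀ l, specProj x l = specProj y l) : x = y := by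
  set T : Finset ℝ := hxf.toFinset ∪ hyf.toFinset with hT
  -- a point below `t` that separates `t` from the smaller elements of `T`
  have hpred : ∀ t : ℝ, ∃ s < t, ∀ u ∈ T, u < t → u ≤ s := by
    intro t
    have h : ∀ᶠ s in nhdsWithin t (Set.Iio t), ∀ u ∈ T, u < t → u ≤ s := by
      rw [Filter.eventually_all_finset]
      intro u _
      by_cases hut : u < t
      · exact (Filter.Eventually.filter_mono nhdsWithin_le_nhds (Ioi_mem_nhds hut)).mono
          fun s hs _ => le_of_lt hs
      · exact Filter.Eventually.of_forall fun s h => absurd h hut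
    obtain ⟨s, hs, hst⟩ := (h.and self_mem_nhdsWithin).exists
    exact ⟨s, hst, hs⟩
  choose s hst hs using hpred
  -- the summand at `t` is `t` times the spectral projection for the point `t`
  have key : ∀ z : A, IsSelfAdjoint z → (spectrum ℝ z).Finite → spectrum ℝ z ⊆ T →
      z = ∑ t ∈ T, t • ((specProj z t : A) - (specProj z (s t) : A)) := by
    intro z hz hzf hzT
    have hc : ∀ g : ℝ → ℝ, ContinuousOn g (spectrum ℝ z) := fun g => hzf.continuousOn g
    calc z = cfc (∑ t ∈ T, fun u : ℝ => t * ((if u ≤ t then (1 : ℝ) else 0) -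
          (if u ≤ s t then (1 : ℝ) else 0))) z := by
          conv_lhs => rw [← cfc_id' ℝ z hz]
          refine cfc_congr fun u hu => ?_
          rw [Finset.sum_apply, Finset.sum_eq_single u]
          · simp [(hst u).not_ge]
          · intro t ht htu
            rcases lt_or_gt_of_ne htu with h1 | h1
            · rw [if_neg h1.not_ge, if_neg (((hst t).trans h1).not_ge)]
              simp
            · rw [if_pos h1.le, if_pos (hs t u (hzT hu) h1)]
              simp
          · exact fun h => absurd (hzT hu) h
      _ = _ := by
          rw [cfc_sum _ _ _ (fun _ _ => hc _)]
          refine Finset.sum_congr rfl fun t _ => ?_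
          rw [cfc_const_mul t _ z (hc _), cfc_sub _ _ z (hc _) (hc _)]
          rfl
  rw [key x hx hxf (by simp [hT]), key y hy hyf (by simp [hT])]
  simp only [h]

theorem specProj_cfc {x : A} (hx : IsSelfAdjoint x) (hf : (spectrum ℝ x).Finite) (g : ℝ → ℝ)
    {l u : ℝ} (h : ∀ t ∈ spectrum ℝ x, g t ≤ u ↔ t ≤ l) :
    specProj (cfc g x) u = specProj x l := by
  refine Subtype.ext ?_
  change cfc _ (cfc g x) = cfc _ x
  rw [← cfc_comp _ g x hx ((hf.image g).continuousOn _) (hf.continuousOn _)]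
  exact cfc_congr fun t ht => by simp only [Function.comp, h t ht]

theorem specProj_of_forall_lt {x : A} {l : ℝ} (h : ∀ t ∈ spectrum ℝ x, l < t) :
    (specProj x l : A) = 0 := by
  rw [← cfc_const_zero ℝ x]
  exact cfc_congr fun t ht => if_neg (h t ht).not_ge

theorem specProj_of_forall_le {x : A} (hx : IsSelfAdjoint x) {l : ℝ}
    (h : ∀ t ∈ spectrum ℝ x, t ≤ l) : (specProj x l : A) = 1 := by
  rw [← cfc_const_one ℝ x]
  exact cfc_congr fun t ht => if_pos (h t ht)

variable [PartialOrder A] [StarOrderedRing A]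

theorem specProj_mono {x : A} (hf : (spectrum ℝ x).Finite) {l u : ℝ} (h : l ≤ u) :
    specProj x l ≤ specProj x u := by
  refine cfc_mono (fun t _ => ?_) (hf.continuousOn _) (hf.continuousOn _)
  split_ifs with h1 h2
  · exact le_rfl
  · exact absurd (h1.trans h) h2
  · exact zero_le_one
  · exact le_rfl

/-- A right-continuity criterion for spectral families: the value at `l` is taken again at some point
to the right of `l`, hence, by monotonicity, in between. -/
theorem isGLB_of_exists_gt {P : Type*} [PartialOrder P] {E : ℝ → P} (hmono : Monotone E) {l : ℝ}
    (h : ∃ u, l < u ∧ E u = E l) : IsGLB (E '' Set.Ioi l) (E l) := by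
  refine ⟨?_, fun Q hQ => ?_⟩
  · rintro _ ⟨u, hu, rfl⟩
    exact hmono (le_of_lt hu)
  · obtain ⟨u, hu, hE⟩ := h
    exact hE ▸ hQ ⟨u, hu, rfl⟩

theorem isSpectralFamilyOf_specProj {x : A} (hx : IsSelfAdjoint x) (hf : (spectrum ℝ x).Finite) :
    IsSpectralFamilyOf (specProj x) x := by
  have hc : ∀ g : ℝ → ℝ, ContinuousOn g (spectrum ℝ x) := fun g => hf.continuousOn g
  have hmono : Monotone (specProj x) := fun _ _ h => specProj_mono hf h
  refine ⟨hx, ⟨hmono, fun l => isGLB_of_exists_gt hmono (exists_gt_specProj_eq hf l), ?_⟩, ?_, ?_⟩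
  · obtain ⟨a, ha⟩ := hf.bddAbove
    obtain ⟨b, hb⟩ := hf.bddBelow
    refine ⟨max 1 (max a (-b)), by positivity, fun l hl => ?_, fun l hl => ?_⟩
    · refine specProj_of_forall_lt fun t ht => ?_
      have h1 := hb ht
      have h2 := (le_max_right a (-b)).trans (le_max_right 1 _)
      linarith
    · refine specProj_of_forall_le hx fun t ht => ?_
      have h1 := ha ht
      have h2 := (le_max_left a (-b)).trans (le_max_right 1 _)
      linarith
  · intro l
    rw [Complex.coe_smul]
    have h1 : x * (specProj x l : A) =
        cfc (fun t : ℝ => t * (if t ≤ l then (1 : ℝ) else 0)) x := by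
      rw [cfc_mul _ _ x (hc _) (hc _), cfc_id' ℝ x hx]
      rfl
    have h2 : l • (specProj x l : A) =
        cfc (fun t : ℝ => l * (if t ≤ l then (1 : ℝ) else 0)) x := by
      rw [cfc_const_mul _ _ x (hc _)]
      rfl
    rw [h1, h2]
    refine cfc_mono (fun t _ => ?_) (hc _) (hc _)
    split_ifs with h <;> simp [h]
  · intro l
    rw [Complex.coe_smul]
    have h0 : 1 - (specProj x l : A) = cfc (fun t : ℝ => 1 - (if t ≤ l then (1 : ℝ) else 0)) x := by
      rw [cfc_sub _ _ x (hc _) (hc _), cfc_const_one ℝ x]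
      rfl
    have h1 : x * (1 - (specProj x l : A)) =
        cfc (fun t : ℝ => t * (1 - (if t ≤ l then (1 : ℝ) else 0))) x := by
      rw [cfc_mul _ _ x (hc _) (hc _), cfc_id' ℝ x hx, h0]
    have h2 : l • (1 - (specProj x l : A)) =
        cfc (fun t : ℝ => l * (1 - (if t ≤ l then (1 : ℝ) else 0))) x := by
      rw [cfc_const_mul _ _ x (hc _), h0]
    rw [h1, h2]
    refine cfc_mono (fun t _ => ?_) (hc _) (hc _)
    split_ifs with h
    · simp
    · simpa using (not_le.1 h).le

/-- The inequality `x * E l ≤ l • E l` makes `x * E l` self-adjoint. -/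
theorem IsSpectralFamilyOf.commute {E : ℝ → Proj A} {x : A} (h : IsSpectralFamilyOf E x) (l : ℝ) :
    Commute x (E l : A) := by
  have h1 : IsSelfAdjoint ((l : ℂ) • (E l : A) - x * (E l : A)) :=
    (sub_nonneg.2 (h.mul_le l)).isSelfAdjoint
  rw [Complex.coe_smul] at h1
  have h2 : IsSelfAdjoint (l • (E l : A)) := (IsSelfAdjoint.all l).smul (E l).2.isSelfAdjoint
  have h3 : IsSelfAdjoint (x * (E l : A)) := by
    have := h2.sub h1
    rwa [sub_sub_cancel] at this
  exact (h.isSelfAdjoint.commute_iff (E l).2.isSelfAdjoint).2 h3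

/-- If `E l * (1 - F u)` were not zero, then on its range `x` would be at most `l` and at least `u`. -/
theorem IsSpectralFamilyOf.le_of_lt {E F : ℝ → Proj A} {x : A} (hE : IsSpectralFamilyOf E x)
    (hF : IsSpectralFamilyOf F x) {l u : ℝ} (hlu : l < u) (hc : Commute (E l : A) (F u : A)) :
    E l ≤ F u := by
  set e : A := (E l).1 with he
  set f : A := 1 - (F u).1 with hf
  have hes : IsStarProjection e := (E l).2
  have hfs : IsStarProjection f := (F u).2.one_sub
  have hef : Commute e f := (Commute.one_right e).sub_right hc
  have hxe : Commute x e := hE.commute l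
  have hxf : Commute x f := (Commute.one_right x).sub_right (hF.commute u)
  have hee : e * e = e := hes.isIdempotentElem
  have hff : f * f = f := hfs.isIdempotentElem
  have h1 : x * (e * f) ≤ l • (e * f) := by
    have := star_left_conjugate_le_conjugate (hE.mul_le l) f
    rw [hfs.isSelfAdjoint.star_eq, Complex.coe_smul, ← he] at this
    have e1 : f * (x * e) * f = x * (e * f) := by
      rw [← mul_assoc, ← hxf.eq, mul_assoc, mul_assoc, ← mul_assoc f e f, ← hef.eq, mul_assoc, hff]
    have e2 : f * (l • e) * f = l • (e * f) := by
      rw [mul_smul_comm, smul_mul_assoc, ← hef.eq, mul_assoc, hff]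
    rwa [e1, e2] at this
  have h2 : u • (e * f) ≤ x * (e * f) := by
    have := star_left_conjugate_le_conjugate (hF.le_mul u) e
    rw [hes.isSelfAdjoint.star_eq, Complex.coe_smul, ← hf] at this
    have e1 : e * (x * f) * e = x * (e * f) := by
      rw [← mul_assoc, ← hxe.eq, mul_assoc, mul_assoc, ← hef.eq, ← mul_assoc e e f, hee]
    have e2 : e * (u • f) * e = u • (e * f) := by
      rw [mul_smul_comm, smul_mul_assoc, mul_assoc, ← hef.eq, ← mul_assoc, hee]
    rwa [e1, e2] at this
  have hQ : 0 ≤ e * f := (hes.mul hfs hef).nonneg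
  have h3 : (u - l) • (e * f) ≤ 0 := by
    rw [sub_smul, sub_nonpos]
    exact h2.trans h1
  have h4 : (u - l) • (e * f) = 0 := le_antisymm h3 (smul_nonneg (sub_nonneg.2 hlu.le) hQ)
  have h5 : e * f = 0 := (smul_eq_zero.1 h4).resolve_left (sub_pos.2 hlu).ne'
  refine ((E l).2.le_iff_mul_eq_left (F u).2).2 ?_
  rw [hf, mul_sub, mul_one, sub_eq_zero] at h5
  exact h5.symm

theorem IsSpectralFamilyOf.le {E F : ℝ → Proj A} {x : A} (hE : IsSpectralFamilyOf E x)
    (hF : IsSpectralFamilyOf F x) (hc : ∀ l u, Commute (E l : A) (F u : A)) (l : ℝ) :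
    E l ≤ F l := by
  refine (hF.isSpectralFamily.isGLB l).2 ?_
  rintro _ ⟨u, hu, rfl⟩
  exact hE.le_of_lt hF hu (hc l u)

/-- Uniqueness of the spectral family of an element with finite spectrum. -/
theorem IsSpectralFamilyOf.eq_specProj {E : ℝ → Proj A} {x : A} (h : IsSpectralFamilyOf E x)
    (hf : (spectrum ℝ x).Finite) : E = specProj x := by
  have hs := isSpectralFamilyOf_specProj h.isSelfAdjoint hf
  have hc : ∀ l u, Commute (E l : A) (specProj x u : A) := fun l u =>
    ((h.commute l).cfc_real _).symm
  funext l
  exact le_antisymm (h.le hs hc l) (hs.le h (fun l u => (hc u l).symm) l)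

end SpectralProjection

/-! ### Spectral families in direct sums -/

section DirectSumFamily

variable {J : Type*} {A : J → Type*} [∀ j, CStarAlgebra (A j)]

/-- The element of a direct sum with given components, all of norm at most `c`. -/
def DirectSumAlg.ofBound (x : ∀ j, A j) (c : ℝ) (h : ∀ j, ‖x j‖ ≤ c) : DirectSumAlg A :=
  ⟨x, memℓp_infty ⟨c, by rintro _ ⟨j, rfl⟩; exact h j⟩⟩

theorem DirectSumAlg.isStarProjection_iff {p : DirectSumAlg A} :
    IsStarProjection p ↔ ∀ j, IsStarProjection (p j) := by
  constructor
  · intro h j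
    exact ⟨congrArg (fun q : DirectSumAlg A => q j) h.isIdempotentElem,
      congrArg (fun q : DirectSumAlg A => q j) h.isSelfAdjoint⟩
  · intro h
    exact ⟨lp.ext (funext fun j => (h j).isIdempotentElem),
      lp.ext (funext fun j => (h j).isSelfAdjoint)⟩

variable [∀ j, Nontrivial (A j)]

/-- The component of a projection in a direct sum. -/
def DirectSumAlg.projComponent (p : Proj (DirectSumAlg A)) (j : J) : Proj (A j) :=
  ⟨p.1 j, DirectSumAlg.isStarProjection_iff.1 p.2 j⟩

/-- The projection in a direct sum with given components. -/
def DirectSumAlg.projOfComponents (p : ∀ j, Proj (A j)) : Proj (DirectSumAlg A) :=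
  ⟨DirectSumAlg.ofBound (fun j => (p j : A j)) 1 fun j => (p j).2.norm_le,
    DirectSumAlg.isStarProjection_iff.2 fun j => (p j).2⟩

variable [∀ j, PartialOrder (A j)]

open DirectSumAlg

theorem component_mem_effects {x : DirectSumAlg A} (hx : x ∈ effects (DirectSumAlg A)) (j : J) :
    x j ∈ effects (A j) :=
  ⟨hx.1 j, (lp.norm_apply_le_norm ENNReal.top_ne_zero x j).trans hx.2⟩

theorem isSpectralFamilyOf_projOfComponents {E : ∀ j, ℝ → Proj (A j)} {x : DirectSumAlg A}
    (h : ∀ j, IsSpectralFamilyOf (E j) (x j)) {a : ℝ} (ha : 0 < a)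
    (h0 : ∀ j l, l < -a → (E j l : A j) = 0) (h1 : ∀ j l, a < l → (E j l : A j) = 1) :
    IsSpectralFamilyOf (fun l => projOfComponents fun j => E j l) x := by
  refine ⟨lp.ext (funext fun j => (h j).isSelfAdjoint), ⟨?_, ?_, a, ha, ?_, ?_⟩, ?_, ?_⟩
  · exact fun l u hlu j => (h j).isSpectralFamily.mono l u hlu
  · intro l
    refine ⟨?_, fun Q hQ j => ?_⟩
    · rintro _ ⟨u, hu, rfl⟩ j
      exact (h j).isSpectralFamily.mono l u (Set.mem_Ioi.1 hu |>.le)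
    · have key : projComponent Q j ∈ lowerBounds (E j '' Set.Ioi l) := ?_
      · exact ((h j).isSpectralFamily.isGLB l).2 key
      rintro _ ⟨u, hu, rfl⟩
      exact hQ ⟨u, hu, rfl⟩ j
  · exact fun l hl => lp.ext (funext fun j => h0 j l hl)
  · exact fun l hl => lp.ext (funext fun j => h1 j l hl)
  · exact fun l j => (h j).mul_le l
  · exact fun l j => (h j).le_mul l

variable [∀ j, StarOrderedRing (A j)]

theorem IsSpectralFamilyOf.component {E : ℝ → Proj (DirectSumAlg A)} {x : DirectSumAlg A}
    (h : IsSpectralFamilyOf E x) (j : J) :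
    IsSpectralFamilyOf (fun l => projComponent (E l) j) (x j) := by
  refine ⟨congrArg (fun q : DirectSumAlg A => q j) h.isSelfAdjoint, ⟨?_, ?_, ?_⟩, ?_, ?_⟩
  · exact fun l u hlu => h.isSpectralFamily.mono l u hlu j
  · intro l
    refine ⟨?_, fun Q hQ => ?_⟩
    · rintro _ ⟨u, hu, rfl⟩
      exact h.isSpectralFamily.mono l u hu.le j
    · -- extend the lower bound `Q` by zero in the other components
      classical
      let Q' : Proj (DirectSumAlg A) := projOfComponents
        (Function.update (fun i => (⟨0, .zero _⟩ : Proj (A i))) j Q)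
      have hQ' : Q' ≤ E l := by
        refine (h.isSpectralFamily.isGLB l).2 ?_
        rintro _ ⟨u, hu, rfl⟩ i
        change ((Function.update (fun i => (⟨0, .zero _⟩ : Proj (A i))) j Q i : Proj (A i)) : A i)
          ≤ (E u).1 i
        rcases eq_or_ne i j with rfl | hij
        · rw [Function.update_self]
          exact hQ ⟨u, hu, rfl⟩
        · rw [Function.update_of_ne hij]
          exact (projComponent (E u) i).2.nonneg
      have := hQ' j
      change ((Function.update (fun i => (⟨0, .zero _⟩ : Proj (A i))) j Q j : Proj (A j)) : A j)
          ≤ (E l).1 j at this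
      rwa [Function.update_self] at this
  · obtain ⟨a, ha, h1, h2⟩ := h.isSpectralFamily.bounded
    exact ⟨a, ha, fun l hl => congrArg (fun q : DirectSumAlg A => q j) (h1 l hl),
      fun l hl => congrArg (fun q : DirectSumAlg A => q j) (h2 l hl)⟩
  · exact fun l => h.mul_le l j
  · exact fun l => h.le_mul l j

end DirectSumFamily

/-! ### Effects -/

section Effects

variable {A : Type*} [CStarAlgebra A] [PartialOrder A] [StarOrderedRing A]

theorem mem_effects_iff {x : A} : x ∈ effects A ↔ 0 ≤ x ∧ x ≤ 1 := by
  refine and_congr_right fun h => ?_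
  exact CStarAlgebra.norm_le_one_iff_of_nonneg x h

theorem spectrum_subset_of_mem_effects {x : A} (hx : x ∈ effects A) :
    spectrum ℝ x ⊆ Set.Icc 0 1 := by
  obtain ⟨h0, h1⟩ := mem_effects_iff.1 hx
  intro t ht
  refine ⟨spectrum_nonneg_of_nonneg h0 ht, ?_⟩
  rw [← map_one (algebraMap ℝ A)] at h1
  exact (le_algebraMap_iff_spectrum_le h0.isSelfAdjoint).1 h1 t ht

theorem specProj_of_neg {x : A} (hx : x ∈ effects A) {l : ℝ} (hl : l < 0) :
    (specProj x l : A) = 0 :=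
  specProj_of_forall_lt fun _ ht => hl.trans_le (spectrum_subset_of_mem_effects hx ht).1

theorem specProj_of_one_le {x : A} (hx : x ∈ effects A) {l : ℝ} (hl : 1 ≤ l) :
    (specProj x l : A) = 1 :=
  specProj_of_forall_le hx.1.isSelfAdjoint fun _ ht =>
    (spectrum_subset_of_mem_effects hx ht).2.trans hl

theorem effectCalc_mem_effects (f : Set.Icc (0 : ℝ) 1 → Set.Icc (0 : ℝ) 1) (x : A) :
    effectCalc f x ∈ effects A :=
  mem_effects_iff.2 ⟨cfc_nonneg fun _ _ => (f _).2.1, cfc_le_one _ _ fun _ _ => (f _).2.2⟩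

/-- A change of scale of `[0, 1]` relabels the spectral projections. -/
theorem specProj_effectCalc {x : A} (hx : x ∈ effects A) (hf : (spectrum ℝ x).Finite)
    (f : Set.Icc (0 : ℝ) 1 ≃o Set.Icc (0 : ℝ) 1) (l : Set.Icc (0 : ℝ) 1) :
    specProj (effectCalc f x) (f l) = specProj x l := by
  refine specProj_cfc hx.1.isSelfAdjoint hf _ fun t ht => ?_
  rw [Set.IccExtend_of_mem _ _ (spectrum_subset_of_mem_effects hx ht), Subtype.coe_le_coe,
    f.le_iff_le, ← Subtype.coe_le_coe]

/-- The spectral order of effects of a direct sum of algebras whose elements have finite spectrum,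
in terms of the spectral projections of the components. -/
theorem spectralLE_iff_specProj_le {J : Type*} {A : J → Type*} [∀ j, CStarAlgebra (A j)]
    [∀ j, Nontrivial (A j)] [∀ j, PartialOrder (A j)] [∀ j, StarOrderedRing (A j)]
    (hfin : ∀ j (a : A j), (spectrum ℝ a).Finite) {x y : DirectSumAlg A}
    (hx : x ∈ effects (DirectSumAlg A)) (hy : y ∈ effects (DirectSumAlg A)) :
    SpectralLE x y ↔ ∀ l j, specProj (y j) l ≤ specProj (x j) l := by
  constructor
  · rintro ⟨E, F, hE, hF, h⟩ l j
    rw [← (hE.component j).eq_specProj (hfin j _), ← (hF.component j).eq_specProj (hfin j _)]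
    exact h l j
  · intro h
    have key : ∀ z ∈ effects (DirectSumAlg A), IsSpectralFamilyOf
        (fun l => DirectSumAlg.projOfComponents fun j => specProj (z j) l) z := fun z hz =>
      isSpectralFamilyOf_projOfComponents
        (fun j => isSpectralFamilyOf_specProj (component_mem_effects hz j).1.isSelfAdjoint
          (hfin j _)) one_pos
        (fun j l hl => specProj_of_neg (component_mem_effects hz j) (by linarith))
        (fun j l hl => specProj_of_one_le (component_mem_effects hz j) hl.le)
    exact ⟨_, _, key x hx, key y hy, fun l j => h l j⟩

/-- For projections `q ≤ p`: the effect with eigenvalue `1` on the range of `q`, eigenvalue `c` on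
the range of `p - q` and eigenvalue `0` on the range of `1 - p`. -/
def twoStepEffect (p q : A) (c : ℝ) : A :=
  c • p + (1 - c) • q

theorem twoStepEffect_mem_effects {p q : A} (hp : IsStarProjection p) (hq : IsStarProjection q)
    {c : ℝ} (h0 : 0 ≤ c) (h1 : c ≤ 1) : twoStepEffect p q c ∈ effects A := by
  refine mem_effects_iff.2 ⟨?_, ?_⟩
  · exact add_nonneg (smul_nonneg h0 hp.nonneg) (smul_nonneg (sub_nonneg.2 h1) hq.nonneg)
  · calc twoStepEffect p q c ≤ c • (1 : A) + (1 - c) • (1 : A) :=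
          add_le_add (smul_le_smul_of_nonneg_left hp.le_one h0)
            (smul_le_smul_of_nonneg_left hq.le_one (sub_nonneg.2 h1))
      _ = 1 := by rw [← add_smul, add_sub_cancel, one_smul]

theorem isSpectralFamilyOf_twoStepEffect {p q : A} (hp : IsStarProjection p)
    (hq : IsStarProjection q) (hle : q ≤ p) {c : ℝ} (h0 : 0 ≤ c) (h1 : c ≤ 1) {E : ℝ → Proj A}
    (hmono : Monotone E) (hright : ∀ l, ∃ u, l < u ∧ E u = E l)
    (hE0 : ∀ l, l < 0 → (E l : A) = 0) (hEp : ∀ l, 0 ≤ l → l < c → (E l : A) = 1 - p)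
    (hEq : ∀ l, 0 ≤ l → c ≤ l → l < 1 → (E l : A) = 1 - q) (hE1 : ∀ l, 1 ≤ l → (E l : A) = 1) :
    IsSpectralFamilyOf E (twoStepEffect p q c) := by
  have heff := twoStepEffect_mem_effects hp hq h0 h1
  have hx := mem_effects_iff.1 heff
  have hpp : p * p = p := hp.isIdempotentElem
  have hqq : q * q = q := hq.isIdempotentElem
  have hpq : p * q = q := (hq.le_iff_mul_eq_right hp).1 hle
  have hqp : q * p = q := (hq.le_iff_mul_eq_left hp).1 hle
  have hxp : twoStepEffect p q c * p = twoStepEffect p q c := by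
    rw [twoStepEffect, add_mul, smul_mul_assoc, smul_mul_assoc, hpp, hqp]
  have hxq : twoStepEffect p q c * q = q := by
    rw [twoStepEffect, add_mul, smul_mul_assoc, smul_mul_assoc, hpq, hqq, ← add_smul,
      add_sub_cancel, one_smul]
  have hcases : ∀ l : ℝ, l < 0 ∨ (0 ≤ l ∧ l < c) ∨ (0 ≤ l ∧ c ≤ l ∧ l < 1) ∨ 1 ≤ l := by
    intro l
    by_contra! h
    linarith [h.2.1 h.1, h.2.2.1 h.1 (h.2.1 h.1)]
  refine ⟨heff.1.isSelfAdjoint, ⟨hmono, fun l => isGLB_of_exists_gt hmono (hright l), 1, one_pos,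
    fun l hl => hE0 l (by linarith), fun l hl => hE1 l hl.le⟩, fun l => ?_, fun l => ?_⟩
  · rw [Complex.coe_smul]
    rcases hcases l with hl | ⟨hl, hlc⟩ | ⟨hl, hlc, hl1⟩ | hl
    · rw [hE0 l hl, mul_zero, smul_zero]
    · rw [hEp l hl hlc, mul_sub, mul_one, hxp, sub_self]
      exact smul_nonneg hl hp.one_sub_nonneg
    · rw [hEq l hl hlc hl1, mul_sub, mul_one, hxq, ← sub_nonneg]
      have : l • (1 - q) - (twoStepEffect p q c - q) = (l - c) • (1 - q) + c • (1 - p) := by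
        rw [twoStepEffect]
        module
      rw [this]
      exact add_nonneg (smul_nonneg (sub_nonneg.2 hlc) hq.one_sub_nonneg)
        (smul_nonneg h0 hp.one_sub_nonneg)
    · rw [hE1 l hl, mul_one]
      refine hx.2.trans ?_
      rw [← sub_nonneg]
      have : l • (1 : A) - 1 = (l - 1) • (1 : A) := by module
      rw [this]
      exact smul_nonneg (sub_nonneg.2 hl) zero_le_one
  · rw [Complex.coe_smul]
    rcases hcases l with hl | ⟨hl, hlc⟩ | ⟨hl, hlc, hl1⟩ | hl
    · rw [hE0 l hl, sub_zero, mul_one]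
      exact (smul_nonpos_of_nonpos_of_nonneg hl.le zero_le_one).trans hx.1
    · rw [hEp l hl hlc, sub_sub_cancel, hxp, ← sub_nonneg]
      have : twoStepEffect p q c - l • p = (c - l) • p + (1 - c) • q := by
        rw [twoStepEffect]
        module
      rw [this]
      exact add_nonneg (smul_nonneg (sub_nonneg.2 hlc.le) hp.nonneg)
        (smul_nonneg (sub_nonneg.2 h1) hq.nonneg)
    · rw [hEq l hl hlc hl1, sub_sub_cancel, hxq, ← sub_nonneg]
      have : q - l • q = (1 - l) • q := by module
      rw [this]
      exact smul_nonneg (sub_nonneg.2 hl1.le) hq.nonneg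
    · rw [hE1 l hl, sub_self, mul_zero, smul_zero]

end Effects

/-! ### Matrix algebras -/

section MatAlg

theorem MatAlg.finite_spectrum {m : ℕ} (x : MatAlg m) : (spectrum ℝ x).Finite := by
  have h : (spectrum ℂ x).Finite := by
    rw [← AlgEquiv.spectrum_eq
      (Module.End.toContinuousLinearMap (𝕜 := ℂ) (EuclideanSpace ℂ (Fin m))).symm x]
    exact Module.End.finite_spectrum _
  rw [← spectrum.preimage_algebraMap ℂ]
  exact h.preimage (FaithfulSMul.algebraMap_injective ℝ ℂ).injOn

/-- Subspaces correspond to the orthogonal projections onto them. -/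
def subspaceProjIso (m : ℕ) : Submodule ℂ (EuclideanSpace ℂ (Fin m)) ≃o Proj (MatAlg m) :=
  RelIso.ofSurjective
    (OrderEmbedding.ofMapLEIff
      (fun S => (⟨S.starProjection, isStarProjection_starProjection⟩ : Proj (MatAlg m)))
      fun _ _ => Submodule.starProjection_le_starProjection_iff)
    fun p => by
      obtain ⟨S, hS, h⟩ := isStarProjection_iff_eq_starProjection.1 p.2
      exact ⟨S, Subtype.ext h.symm⟩

/-- The complementation `p ↦ 1 - p` of projections. -/
def projCompl (A : Type*) [CStarAlgebra A] [PartialOrder A] [StarOrderedRing A] :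
    Proj A ≃o (Proj A)ᵒᵈ where
  toFun p := OrderDual.toDual ⟨1 - p.1, p.2.one_sub⟩
  invFun p := ⟨1 - (OrderDual.ofDual p).1, (OrderDual.ofDual p).2.one_sub⟩
  left_inv p := Subtype.ext (sub_sub_cancel 1 p.1)
  right_inv p := Subtype.ext (sub_sub_cancel 1 (OrderDual.ofDual p).1)
  map_rel_iff' := sub_le_sub_iff_left (1 : A)

/-- Projections correspond to subspaces by their kernels; this reverses the order. -/
def projKerIso (m : ℕ) : Proj (MatAlg m) ≃o (Submodule ℂ (EuclideanSpace ℂ (Fin m)))ᵒᵈ :=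
  (projCompl (MatAlg m)).trans (subspaceProjIso m).symm.dual

theorem coe_projKerIso_symm {m : ℕ} (S : Submodule ℂ (EuclideanSpace ℂ (Fin m))) :
    ((projKerIso m).symm (OrderDual.toDual S) : MatAlg m) = 1 - S.starProjection := rfl

theorem projKerIso_of_eq_zero {m : ℕ} {p : Proj (MatAlg m)} (hp : (p : MatAlg m) = 0) :
    projKerIso m p = OrderDual.toDual ⊤ := by
  rw [← OrderIso.eq_symm_apply]
  refine Subtype.ext ?_
  rw [coe_projKerIso_symm, hp, Submodule.starProjection_top]
  exact (sub_self _).symm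

theorem projKerIso_of_eq_one {m : ℕ} {p : Proj (MatAlg m)} (hp : (p : MatAlg m) = 1) :
    projKerIso m p = OrderDual.toDual ⊥ := by
  rw [← OrderIso.eq_symm_apply]
  refine Subtype.ext ?_
  rw [coe_projKerIso_symm, hp, Submodule.starProjection_bot]
  exact (sub_zero _).symm

/-- The kernel of the spectral projection of `x` for `(-∞, l]`, that is, the sum of the eigenspaces
for the eigenvalues in `(l, ∞)`. -/
def specKer {m : ℕ} (x : MatAlg m) (l : ℝ) : Submodule ℂ (EuclideanSpace ℂ (Fin m)) :=
  OrderDual.ofDual (projKerIso m (specProj x l))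

theorem specKer_le_specKer_iff {m : ℕ} {x y : MatAlg m} {l u : ℝ} :
    specKer x l ≤ specKer y u ↔ specProj y u ≤ specProj x l := by
  rw [← (projKerIso m).le_iff_le]
  rfl

theorem specKer_of_neg {m : ℕ} {x : MatAlg m} (hx : x ∈ effects (MatAlg m)) {l : ℝ} (hl : l < 0) :
    specKer x l = ⊤ :=
  projKerIso_of_eq_zero (specProj_of_neg hx hl)

theorem specKer_of_one_le {m : ℕ} {x : MatAlg m} (hx : x ∈ effects (MatAlg m)) {l : ℝ}
    (hl : 1 ≤ l) : specKer x l = ⊥ :=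
  projKerIso_of_eq_one (specProj_of_one_le hx hl)

theorem specKer_twoStepEffect {m : ℕ} {W W' : Submodule ℂ (EuclideanSpace ℂ (Fin m))}
    (hW : W' ≤ W) {c : ℝ} (h0 : 0 ≤ c) (h1 : c ≤ 1) (l : ℝ) :
    specKer (twoStepEffect (W.starProjection : MatAlg m) W'.starProjection c) l =
      stepLevel W W' c l := by
  have h : IsSpectralFamilyOf
      (fun l => (projKerIso m).symm (OrderDual.toDual (stepLevel W W' c l)))
      (twoStepEffect (W.starProjection : MatAlg m) W'.starProjection c) := by
    refine isSpectralFamilyOf_twoStepEffect isStarProjection_starProjection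
      isStarProjection_starProjection (Submodule.starProjection_le_starProjection_iff.2 hW) h0 h1
      (fun l u hlu => (projKerIso m).symm.monotone (antitone_stepLevel hW hlu)) (fun l => ?_)
      (fun l hl => ?_) (fun l hl hlc => ?_) (fun l hl hlc hl1 => ?_) (fun l hl => ?_)
    · obtain ⟨u, hu, h⟩ := exists_gt_stepLevel_eq W W' c l
      exact ⟨u, hu, by simp only [h]⟩
    · rw [stepLevel_of_neg _ _ _ hl, coe_projKerIso_symm, Submodule.starProjection_top]
      exact sub_self _
    · rw [stepLevel_of_lt hl hlc, coe_projKerIso_symm]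
    · rw [stepLevel_of_ge hl hlc hl1, coe_projKerIso_symm]
    · rw [stepLevel, if_neg (by linarith), if_neg (by linarith), if_neg hl.not_gt,
        coe_projKerIso_symm, Submodule.starProjection_bot]
      exact sub_zero _
  rw [specKer, ← h.eq_specProj (MatAlg.finite_spectrum _), OrderIso.apply_symm_apply]
  rfl

/-- On the line through two points of a complex vector space there is a third one: the sum of
representing vectors. -/
theorem Submodule.atomsPerspective {E : Type*} [AddCommGroup E] [Module ℂ E] (p q : Submodule ℂ E)
    (hp : IsAtom p) (hq : IsAtom q) (hpq : p ≠ q) : AtomsPerspective p q := by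
  obtain ⟨v, hv, rfl⟩ := (atom_iff_nonzero_span p).1 hp
  obtain ⟨w, hw, rfl⟩ := (atom_iff_nonzero_span q).1 hq
  have hv1 : v ∈ span ℂ {v} := mem_span_singleton_self v
  have hw1 : w ∈ span ℂ {w} := mem_span_singleton_self w
  have hvw1 : v + w ∈ span ℂ {v + w} := mem_span_singleton_self _
  have hv2 : v ∉ span ℂ {w} := fun h => hpq
    ((hq.le_iff_eq hp.1).1 ((span_singleton_le_iff_mem v _).2 h))
  have hw2 : w ∉ span ℂ {v} := fun h => hpq
    ((hp.le_iff_eq hq.1).1 ((span_singleton_le_iff_mem w _).2 h)).symm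
  have hvw : v + w ≠ 0 := fun h => hv2 (by
    rw [eq_neg_of_add_eq_zero_left h]
    exact neg_mem hw1)
  refine ⟨span ℂ {v + w}, nonzero_span_atom _ hvw, fun h => hw2 ?_, fun h => hv2 ?_, ?_, ?_⟩
  · rw [← h] at hvw1
    simpa using sub_mem hvw1 hv1
  · rw [← h] at hvw1
    simpa using sub_mem hvw1 hw1
  · rw [span_singleton_le_iff_mem]
    have := sub_mem (mem_sup_right (S := span ℂ {w}) hvw1) (mem_sup_left hw1)
    simpa using this
  · rw [span_singleton_le_iff_mem]
    have := sub_mem (mem_sup_right (S := span ℂ {v}) hvw1) (mem_sup_left hv1)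
    simpa using this

theorem dim_eq_of_orderIso {m n : ℕ}
    (t : Submodule ℂ (EuclideanSpace ℂ (Fin m)) ≃o Submodule ℂ (EuclideanSpace ℂ (Fin n))) :
    m = n := by
  have h := Order.krullDim_eq_of_orderIso t
  rw [← Module.coe_length, ← Module.coe_length, Module.length_eq_finrank,
    Module.length_eq_finrank] at h
  simpa using h

theorem spectralLE_iff_specKer_le {J : Type*} (d : J → ℕ) [∀ j, NeZero (d j)]
    (x y : effects (DirectSumAlg fun j => MatAlg (d j))) :
    SpectralLE (x : DirectSumAlg fun j => MatAlg (d j)) y ↔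
      (fun l j => specKer (x.1 j) l) ≤ fun l j => specKer (y.1 j) l := by
  rw [spectralLE_iff_specProj_le (fun j => MatAlg.finite_spectrum) x.2 y.2]
  exact forall_congr' fun l => forall_congr' fun j => specKer_le_specKer_iff.symm

/-- The effects of a direct sum of matrix algebras form a level system, by the kernels of the
spectral projections of the components. -/
theorem isLevelSystem_effects {Λ : Type*} (m : Λ → ℕ) [∀ j, NeZero (m j)] :
    IsLevelSystem fun (x : effects (DirectSumAlg fun j => MatAlg (m j))) l j =>
      specKer (x.1 j) l where
  antitone x l u hlu j :=
    specKer_le_specKer_iff.2 (specProj_mono (MatAlg.finite_spectrum _) hlu)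
  of_neg x l hl := funext fun j => specKer_of_neg (component_mem_effects x.2 j) hl
  of_one_le x l hl := funext fun j => specKer_of_one_le (component_mem_effects x.2 j) hl
  exists_gt x l q hq h := by
    obtain ⟨j, a, ha, rfl⟩ := exists_eq_piSingleBot hq
    obtain ⟨u, hu, hE⟩ := exists_gt_specProj_eq (MatAlg.finite_spectrum (x.1 j)) l
    refine ⟨u, hu, ?_⟩
    rw [piSingleBot_le_iff] at h ⊢
    rwa [specKer, hE]
  injective x y h := by
    refine Subtype.ext (lp.ext (funext fun j => ?_))
    refine eq_of_specProj_eq (component_mem_effects x.2 j).1.isSelfAdjoint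
      (component_mem_effects y.2 j).1.isSelfAdjoint (MatAlg.finite_spectrum _)
      (MatAlg.finite_spectrum _) fun l => ?_
    exact (projKerIso (m j)).injective (congrFun (congrFun h l) j)
  exists_step W W' c hW h0 h1 := by
    have heff : ∀ j, twoStepEffect ((W j).starProjection : MatAlg (m j)) (W' j).starProjection c ∈
        effects (MatAlg (m j)) := fun j =>
      twoStepEffect_mem_effects isStarProjection_starProjection isStarProjection_starProjection
        h0 h1
    refine ⟨⟨DirectSumAlg.ofBound (fun j =>
      twoStepEffect ((W j).starProjection : MatAlg (m j)) (W' j).starProjection c) 1 fun j => (heff j).2,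
      fun j => (heff j).1, ?_⟩, ?_⟩
    · exact lp.norm_le_of_forall_le zero_le_one fun j => (heff j).2
    · funext l j
      refine (specKer_twoStepEffect (hW j) h0 h1 l).trans ?_
      unfold stepLevel
      split_ifs <;> rfl

end MatAlg

/-! ### The form of spectral order isomorphisms -/

/-- The isomorphism of projection lattices induced by an isomorphism `t` of subspace lattices acting
on the kernels of projections. -/
def projIsoOfKerIso {m n : ℕ}
    (t : Submodule ℂ (EuclideanSpace ℂ (Fin m)) ≃o Submodule ℂ (EuclideanSpace ℂ (Fin n))) :
    Proj (MatAlg m) ≃o Proj (MatAlg n) :=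
  ((projKerIso m).trans t.dual).trans (projKerIso n).symm

/-- It suffices to compare kernels of spectral projections on `[0, 1]`, as the families of effects are
constant outside of it. -/
theorem isTheta_effectCalc {m n : ℕ} {x : MatAlg m} {z : MatAlg n} (hx : x ∈ effects (MatAlg m))
    (hz : z ∈ effects (MatAlg n)) (f : Set.Icc (0 : ℝ) 1 ≃o Set.Icc (0 : ℝ) 1)
    (t : Submodule ℂ (EuclideanSpace ℂ (Fin m)) ≃o Submodule ℂ (EuclideanSpace ℂ (Fin n)))
    (h : ∀ l : Set.Icc (0 : ℝ) 1, specKer z (f l) = t (specKer x l)) :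
    IsTheta (projIsoOfKerIso t) (effectCalc f x) z := by
  have hfx := effectCalc_mem_effects f x
  refine ⟨specProj (effectCalc f x),
    isSpectralFamilyOf_specProj hfx.1.isSelfAdjoint (MatAlg.finite_spectrum _), ?_⟩
  have key : (fun l => projIsoOfKerIso t (specProj (effectCalc f x) l)) = specProj z := by
    funext l
    refine (projKerIso n).injective (OrderDual.ofDual.injective ?_)
    change OrderDual.ofDual (projKerIso n ((projKerIso n).symm (OrderDual.toDual
      (t (specKer (effectCalc f x) l))))) = specKer z l
    rw [OrderIso.apply_symm_apply, OrderDual.ofDual_toDual]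
    rcases lt_or_ge l 0 with h0 | h0
    · rw [specKer_of_neg hfx h0, specKer_of_neg hz h0, map_top]
    rcases le_or_gt 1 l with h1 | h1
    · rw [specKer_of_one_le hfx h1, specKer_of_one_le hz h1, map_bot]
    obtain ⟨u, hu⟩ := f.surjective ⟨l, h0, h1.le⟩
    have hul : (f u : ℝ) = l := congrArg Subtype.val hu
    rw [← hul, h, specKer, specProj_effectCalc hx (MatAlg.finite_spectrum _)]
    rfl
  rw [key]
  exact isSpectralFamilyOf_specProj hz.1.isSelfAdjoint (MatAlg.finite_spectrum _)

/-- A lattice isomorphism between the projections of `B(ℂᵐ)` and `B(ℂⁿ)`, with `m = n`, read as an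
automorphism. -/
theorem exists_automorphism_isTheta {m n : ℕ} (h : m = n) (τ : Proj (MatAlg m) ≃o Proj (MatAlg n)) :
    ∃ σ : Proj (MatAlg m) ≃o Proj (MatAlg m), ∀ (x : MatAlg m) (z : MatAlg n), IsTheta τ x z →
      ∃ y, IsTheta σ x y ∧ z = MatAlg.cast h y := by
  subst h
  exact ⟨τ, fun x z hz => ⟨z, hz, rfl⟩⟩

end

theorem corollary3p3 {Λ Γ : Type*} (m : Λ → ℕ) (n : Γ → ℕ)
    [∀ j, NeZero (m j)] [∀ k, NeZero (n k)]
    (Φ : effects (DirectSumAlg fun j => MatAlg (m j)) →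
      effects (DirectSumAlg fun k => MatAlg (n k)))
    (hΦ : IsSpectralOrderIso Φ) :
    ∃ (π : Γ ≃ Λ) (hdim : ∀ k, m (π k) = n k)
      (f : Λ → Set.Icc (0 : ℝ) 1 → Set.Icc (0 : ℝ) 1)
      (τ : ∀ j, Proj (MatAlg (m j)) ≃o Proj (MatAlg (m j))),
      (∀ j, StrictMono (f j) ∧ Function.Bijective (f j)) ∧
      ∀ (x : effects (DirectSumAlg fun j => MatAlg (m j))) (k : Γ),
        ∃ y : MatAlg (m (π k)),
          IsTheta (τ (π k)) (effectCalc (f (π k)) (x.1 (π k))) y ∧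
          (Φ x).1 k = MatAlg.cast (hdim k) y := by
  obtain ⟨hbij, hord⟩ := hΦ
  obtain ⟨π, t, f, h⟩ := IsLevelSystem.exists_decomposition
    (fun j => Submodule.atomsPerspective) (fun k => Submodule.atomsPerspective)
    (isLevelSystem_effects m) (isLevelSystem_effects n) (Equiv.ofBijective Φ hbij)
    (fun x y => by
      rw [← spectralLE_iff_specKer_le, ← spectralLE_iff_specKer_le]
      exact hord x y)
  have hdim : ∀ k, m (π k) = n k := fun k => dim_eq_of_orderIso (t k)
  choose σ hσ using fun k => exists_automorphism_isTheta (hdim k) (projIsoOfKerIso (t k))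
  -- transport the family of automorphisms from the index set `Γ` to `Λ`
  refine ⟨π, hdim, fun j => f j, Equiv.piCongrLeft
    (fun j => Proj (MatAlg (m j)) ≃o Proj (MatAlg (m j))) π σ,
    fun j => ⟨(f j).strictMono, (f j).bijective⟩, fun x k => ?_⟩
  rw [Equiv.piCongrLeft_apply_apply]
  exact hσ k _ _ (isTheta_effectCalc (component_mem_effects x.2 (π k))
    (component_mem_effects (Φ x).2 k) (f (π k)) (t k) fun l => h x k l)
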